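/- Let $(c_k)_{k\ge 0}$ be the sequence of orthorecursive coefficients, determined by $c_0=1$ and $$\sum_{k=0}^{N}\frac{c_k}{N+k+1}=0\qquad(N\ge 1).$$ Let $\psi=\Gamma'/\Gamma$ be the digamma function and let $g^*$ be the meromorphic function on $\mathbb{C}$ $$g^*(z)=z\left(\psi\!\left(-\frac z2\right)-\psi\!\left(\frac{1-z}2\right)\right)$$ (with its removable singularity at $z=0$ removed). Then $g^*$ is the modified Mellin transform of $g(t)=2/(1+t)$, that is, the meromorphic continuation to $\mathbb{C}$ of $z\mapsto -z\int_0^1 g(t)\,t^{-z-1}\,dt$, where the integral converges absolutely for $\operatorname{Re}(z)$ sufficiently negative. The set of real parts of the zeros of $g^*$ has a least element $\alpha_1$, and $|\alpha_1-1.3465|<5\cdot 10^{-5}$. For every $\varepsilon>0$ there is a constant $K_\varepsilon$ such that for all $N\ge 1$ $$\left|\sum_{k=0}^{N}c_k\right|\le K_\varepsilon\,N^{-\alpha_1+\varepsilon},$$ that is, $\sum_{k\le N}c_k=O_\varepsilon(N^{-\alpha_1+\varepsilon})$. -/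

import Mathlib

/-- `G` is the modified Mellin transform of `g : (0,1] → ℂ`: a meromorphic function on `ℂ` which
is given by `-z ∫_0^1 g(t) t^(-z-1) dt`, with an absolutely convergent integral, when `Re z` is
sufficiently negative. By the identity theorem `G` is determined up to its values on a discrete
set. -/
def IsModifiedMellinTransform (g : ℝ → ℂ) (G : ℂ → ℂ) : Prop :=
  Meromorphic G ∧
    ∃ σ : ℝ, ∀ z : ℂ, z.re < σ →
      MeasureTheory.IntegrableOn (fun t : ℝ => g t * (t : ℂ) ^ (-z - 1)) (Set.Ioc 0 1) ∧
        G z = -z * ∫ t in Set.Ioc (0 : ℝ) 1, g t * (t : ℂ) ^ (-z - 1)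

/-- The kernel `g(t) = 2 / (1 + t)`. -/
noncomputable def orthoKernel (t : ℝ) : ℂ := 2 / (1 + (t : ℂ))

/-- The function `g*(z) = z (ψ(-z/2) - ψ((1-z)/2))`. At the nonnegative integers, where one of the
two digamma values is at a pole, this expression takes a conventional value; it is used only as a
meromorphic function, and its zeros are read off from `meromorphicOrderAt`, which ignores the value
at the point itself (so that for instance the removable singularity at `0`, where `g*` tends
to `2`, is not a zero). -/
noncomputable def gStar (z : ℂ) : ℂ :=
  z * (Complex.digamma (-z / 2) - Complex.digamma ((1 - z) / 2))

/-- `z` is a zero of the meromorphic function `G`: its order at `z` is positive. -/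
def IsMeromorphicZero (G : ℂ → ℂ) (z : ℂ) : Prop :=
  MeromorphicAt G z ∧ 0 < meromorphicOrderAt G z

/-!
# Decay of the partial sums of the orthorecursive coefficients

Write `A n = c 0 + ... + c n` and `x k = k + 1/2`. The recurrence says `∑_{k ≤ N} c k / (x N + x k)
= 0`, so in the logarithmic variable `u = log x` it is a discrete convolution equation with kernel
`h u = 2 / (1 + e^u)` on the half-line, while `A N / x N` is the sum of the `c k / x k` against
`e^(-u)`. If `r` is a kernel with `e^(-u) = h + r * h` on `u ≥ 0` (`exists_resolvent`), then
`A N / x N` is the integral of `r` against the sums `∑_{x k ≤ y} 2 c k / (y + x k)` for real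
`y ≤ x N` (`partialSum_eq_integral`). These sums vanish at the nodes `y = x n`, `n ≥ 1`, and Abel
summation bounds them by `y^(-a-2)` whenever `A k = O(k^(-a))` with `a < 1`
(`exists_abs_sum_div_le`). As `r` decays like `e^(-(1+b)u)` for every `b` below the real parts of
the zeros of `g*`, a decay of order `a` of `A` improves to any order `b < a + 1` of this kind
(`exists_abs_partialSum_le_of_decay`). The recurrence gives `|A k| ≤ 1` at once; since
`α₁ < 1.9`, the two steps `0 → 0.9 → α₁ - ε` suffice.

On the Fourier side, `r` has symbol `1/g* - 1`. With `s = 2 - z` one has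
`g*(z) = 2 G(s) / (s - 1)`, where `G = zeroFn` is `s/2 - 1/4 + 2 ∫_0^1 t^(s-1) (1+t)^(-3) dt`, and
from this form `1/g* - 1 + 1/(2s) = O(1/|s|^2)` in any half-plane `Re s ≥ σ > 0` without zeros. The
decay of the inverse transform follows by shifting the line of integration
(`exists_continuous_kernel`), and the term `-1/(2s)` is the transform of an explicit exponential.

It remains to locate the rightmost zeros of `G` (`exists_rightmost_zero`). In the sector
`|Im s| ≤ Re s`, `Re s ≥ 0.65`, there is none, by direct estimates. In the sector `Im s ≥ Re s`,
`Re s ≥ 0.65`, the function `(1+t)^(-3)` is replaced by `1 - 1.3 t` up to a remainder whose Mellin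
transform has a small Lipschitz constant, which shows that a zero with `|s| ≤ 2` is the only one in
this sector (`zeroFn_zero_unique`). Finally the contraction principle, with a rigorous evaluation
of `G` at one point, produces a zero within `3.3e-5` of `0.653484 + 1.05516 i`
(`exists_zeroFn_eq_zero`). The link with the digamma function is
`ψ((w+1)/2) - ψ(w/2) = 2 ∫_0^1 t^(w-1) / (1+t) dt` (`digamma_sub_digamma_eq`).
-/

open MeasureTheory Set Filter Topology

/-! ### Mellin transforms on the unit interval -/

/-- The Mellin transform `∫_0^1 t^(s-1) f(t) dt` of a real function restricted to `(0, 1]`. -/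
noncomputable def unitMellin (f : ℝ → ℝ) (s : ℂ) : ℂ :=
  ∫ t in Ioc (0 : ℝ) 1, (t : ℂ) ^ (s - 1) * (f t : ℂ)

lemma integrableOn_rpow_sub_one {σ : ℝ} (hσ : 0 < σ) :
    IntegrableOn (fun t : ℝ => t ^ (σ - 1)) (Ioc 0 1) := by
  have := intervalIntegral.intervalIntegrable_rpow' (a := 0) (b := 1) (r := σ - 1) (by linarith)
  rwa [intervalIntegrable_iff_integrableOn_Ioc_of_le zero_le_one] at this

lemma integral_rpow_sub_one {σ : ℝ} (hσ : 0 < σ) :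
    ∫ t in Ioc (0 : ℝ) 1, t ^ (σ - 1) = 1 / σ := by
  rw [← intervalIntegral.integral_of_le zero_le_one, integral_rpow (Or.inl (by linarith))]
  simp [Real.zero_rpow hσ.ne']

lemma integrableOn_unitMellin {f : ℝ → ℝ} (hf : ContinuousOn f (Icc 0 1)) {s : ℂ}
    (hs : 0 < s.re) :
    IntegrableOn (fun t : ℝ => (t : ℂ) ^ (s - 1) * (f t : ℂ)) (Ioc 0 1) := by
  obtain ⟨C, hC⟩ := isCompact_Icc.exists_bound_of_continuousOn hf
  have hm : ContinuousOn (fun t : ℝ => (t : ℂ) ^ (s - 1) * (f t : ℂ)) (Ioc 0 1) := by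
    refine ContinuousOn.mul (fun t ht => ?_) ?_
    · exact (Complex.continuousAt_ofReal_cpow_const _ _ (Or.inr ht.1.ne')).continuousWithinAt
    · exact Complex.continuous_ofReal.comp_continuousOn (hf.mono Ioc_subset_Icc_self)
  refine Integrable.mono' ((integrableOn_rpow_sub_one hs).mul_const C)
    (hm.aestronglyMeasurable measurableSet_Ioc) ?_
  filter_upwards [ae_restrict_mem measurableSet_Ioc] with t ht
  rw [norm_mul, Complex.norm_cpow_eq_rpow_re_of_pos ht.1, Complex.norm_real, Complex.sub_re,
    Complex.one_re]
  exact mul_le_mul_of_nonneg_left (hC t (Ioc_subset_Icc_self ht)) (Real.rpow_nonneg ht.1.le _)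

lemma unitMellin_add {f g : ℝ → ℝ} (hf : ContinuousOn f (Icc 0 1)) (hg : ContinuousOn g (Icc 0 1))
    {s : ℂ} (hs : 0 < s.re) :
    unitMellin (fun t => f t + g t) s = unitMellin f s + unitMellin g s := by
  unfold unitMellin
  rw [← integral_add (integrableOn_unitMellin hf hs) (integrableOn_unitMellin hg hs)]
  simp [mul_add]

lemma unitMellin_const_mul (f : ℝ → ℝ) (c : ℝ) (s : ℂ) :
    unitMellin (fun t => c * f t) s = c * unitMellin f s := by
  unfold unitMellin
  rw [← integral_const_mul]
  congr 1 with t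
  push_cast; ring

lemma unitMellin_congr {f g : ℝ → ℝ} (h : ∀ t ∈ Ioc (0 : ℝ) 1, f t = g t) (s : ℂ) :
    unitMellin f s = unitMellin g s :=
  setIntegral_congr_fun measurableSet_Ioc fun t ht => by simp only [h t ht]

lemma unitMellin_mul_id (f : ℝ → ℝ) (s : ℂ) :
    unitMellin (fun t => t * f t) s = unitMellin f (s + 1) := by
  refine setIntegral_congr_fun measurableSet_Ioc fun t ht => ?_
  have ht' : (t : ℂ) ≠ 0 := Complex.ofReal_ne_zero.mpr ht.1.ne'
  simp only
  rw [show s + 1 - 1 = (s - 1) + 1 by ring, Complex.cpow_add _ _ ht', Complex.cpow_one]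
  push_cast; ring

lemma unitMellin_one {s : ℂ} (hs : 0 < s.re) : unitMellin (fun _ => 1) s = 1 / s := by
  unfold unitMellin
  have h0 : s ≠ 0 := by rintro rfl; simp at hs
  rw [← intervalIntegral.integral_of_le zero_le_one]
  simp only [Complex.ofReal_one, mul_one]
  rw [integral_cpow (Or.inl (by simpa using hs))]
  simp [Complex.zero_cpow h0]

lemma unitMellin_pow (k : ℕ) {s : ℂ} (hs : 0 < s.re) :
    unitMellin (fun t => t ^ k) s = 1 / (s + k) := by
  induction k generalizing s with
  | zero => simpa using unitMellin_one hs
  | succ k ih =>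
    have : unitMellin (fun t => t ^ (k + 1)) s = unitMellin (fun t => t * t ^ k) s :=
      unitMellin_congr (fun t _ => by ring) s
    rw [this, unitMellin_mul_id, ih (by simp; linarith)]
    push_cast; ring_nf

lemma norm_unitMellin_le {f g : ℝ → ℝ} {s : ℂ} {σ : ℝ} (hσ : σ ≤ s.re)
    (hg : IntegrableOn (fun t : ℝ => t ^ (σ - 1) * g t) (Ioc 0 1))
    (h : ∀ t ∈ Ioc (0 : ℝ) 1, |f t| ≤ g t) :
    ‖unitMellin f s‖ ≤ ∫ t in Ioc (0 : ℝ) 1, t ^ (σ - 1) * g t := by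
  refine norm_integral_le_of_norm_le hg ?_
  filter_upwards [ae_restrict_mem measurableSet_Ioc] with t ht
  rw [norm_mul, Complex.norm_cpow_eq_rpow_re_of_pos ht.1, Complex.norm_real, Complex.sub_re,
    Complex.one_re, Real.norm_eq_abs]
  exact mul_le_mul (Real.rpow_le_rpow_of_exponent_ge ht.1 ht.2 (by linarith)) (h t ht)
    (abs_nonneg _) (Real.rpow_nonneg ht.1.le _)

lemma norm_unitMellin_le_const {f : ℝ → ℝ} {s : ℂ} {C : ℝ} (hs : 0 < s.re)
    (h : ∀ t ∈ Ioc (0 : ℝ) 1, |f t| ≤ C) : ‖unitMellin f s‖ ≤ C / s.re := by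
  have h1 : IntegrableOn (fun t : ℝ => t ^ (s.re - 1) * C) (Ioc 0 1) :=
    (integrableOn_rpow_sub_one hs).mul_const C
  refine (norm_unitMellin_le le_rfl h1 h).trans ?_
  rw [integral_mul_const, integral_rpow_sub_one hs]
  exact le_of_eq (by ring)

lemma unitMellin_eq_mellin (f : ℝ → ℝ) (s : ℂ) :
    unitMellin f s = mellin ((Ioc (0 : ℝ) 1).indicator fun t => (f t : ℂ)) s := by
  unfold unitMellin mellin
  rw [← integral_indicator measurableSet_Ioc, ← integral_indicator measurableSet_Ioi]
  congr 1 with t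
  by_cases h : t ∈ Ioc (0 : ℝ) 1
  · simp [h, h.1]
  · simp only [indicator_of_notMem h]
    simp only [indicator_apply, if_neg h, smul_zero, ite_self]

lemma differentiableAt_unitMellin {f : ℝ → ℝ} (hf : ContinuousOn f (Icc 0 1)) {s : ℂ}
    (hs : 0 < s.re) : DifferentiableAt ℂ (unitMellin f) s := by
  rw [show unitMellin f = _ from funext (unitMellin_eq_mellin f)]
  obtain ⟨C, hC⟩ := isCompact_Icc.exists_bound_of_continuousOn hf
  refine mellin_differentiableAt_of_isBigO_rpow (a := s.re + 1) (b := 0) ?_ ?_ (by linarith) ?_ hs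
  · refine IntegrableOn.locallyIntegrableOn ?_
    refine Integrable.integrableOn ?_
    rw [integrable_indicator_iff measurableSet_Ioc]
    refine IntegrableOn.mono_set ?_ Ioc_subset_Icc_self
    exact (Complex.continuous_ofReal.comp_continuousOn hf).integrableOn_compact isCompact_Icc
  · refine (Asymptotics.isBigO_zero (E' := ℂ) _ _).congr' ?_ EventuallyEq.rfl
    filter_upwards [eventually_gt_atTop 1] with t ht
    rw [indicator_of_notMem]
    exact fun h => absurd h.2 (not_le.mpr ht)
  · refine Asymptotics.IsBigO.of_bound C ?_
    filter_upwards [Ioc_mem_nhdsGT (zero_lt_one' ℝ)] with t ht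
    rw [indicator_of_mem ht]
    simpa using hC t (Ioc_subset_Icc_self ht)

/-! ### The integrals `∫_0^1 t^(s-1) (1+t)^(-n) dt` -/

/-- The integral `∫_0^1 t^(s-1) (1+t)^(-n) dt`; for `n = 1` it is the beta function
`∑ (-1)^k / (s + k)`. -/
noncomputable def altBeta (n : ℕ) : ℂ → ℂ := unitMellin fun t => ((1 + t) ^ n)⁻¹

lemma continuousOn_inv_one_add_pow (n : ℕ) :
    ContinuousOn (fun t : ℝ => ((1 + t) ^ n)⁻¹) (Icc 0 1) := by
  refine ContinuousOn.inv₀ (by fun_prop) fun t ht => ?_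
  have := ht.1
  positivity

lemma abs_inv_one_add_pow_le (n : ℕ) {t : ℝ} (ht : 0 < t) : |((1 + t) ^ n)⁻¹| ≤ 1 := by
  rw [abs_of_pos (by positivity)]
  exact inv_le_one_of_one_le₀ (one_le_pow₀ (by linarith))

lemma norm_altBeta_le (n : ℕ) {s : ℂ} (hs : 0 < s.re) : ‖altBeta n s‖ ≤ 1 / s.re :=
  norm_unitMellin_le_const hs fun _ ht => abs_inv_one_add_pow_le n ht.1

lemma differentiableAt_altBeta (n : ℕ) {s : ℂ} (hs : 0 < s.re) :
    DifferentiableAt ℂ (altBeta n) s :=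
  differentiableAt_unitMellin (continuousOn_inv_one_add_pow n) hs

lemma altBeta_zero {s : ℂ} (hs : 0 < s.re) : altBeta 0 s = 1 / s := by
  simpa [altBeta] using unitMellin_one hs

/-- `(1+t)^(-n) = (1+t)^(-n-1) + t (1+t)^(-n-1)`. -/
lemma altBeta_split (n : ℕ) {s : ℂ} (hs : 0 < s.re) :
    altBeta n s = altBeta (n + 1) s + altBeta (n + 1) (s + 1) := by
  unfold altBeta
  rw [← unitMellin_mul_id, ← unitMellin_add (continuousOn_inv_one_add_pow _)
    (g := fun t => t * ((1 + t) ^ (n + 1))⁻¹)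
    (continuousOn_id.mul (continuousOn_inv_one_add_pow _)) hs]
  refine unitMellin_congr (fun t ht => ?_) s
  have : 1 + t ≠ 0 := by linarith [ht.1]
  field_simp
  ring

/-- Integration by parts. -/
lemma mul_altBeta (n : ℕ) {s : ℂ} (hs : 0 < s.re) :
    s * altBeta n s = 1 / 2 ^ n + n * altBeta (n + 1) (s + 1) := by
  have h0 : s ≠ 0 := by rintro rfl; simp at hs
  have hd : ∀ t ∈ Ioo (0 : ℝ) 1, HasDerivAt (fun t : ℝ => (t : ℂ) ^ s * (((1 + t) ^ n)⁻¹ : ℝ))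
      (s * ((t : ℂ) ^ (s - 1) * (((1 + t) ^ n)⁻¹ : ℝ)) -
        n * ((t : ℂ) ^ (s + 1 - 1) * (((1 + t) ^ (n + 1))⁻¹ : ℝ))) t := by
    intro t ht
    have ht0 : (0 : ℝ) < 1 + t := by linarith [ht.1]
    have h1 : HasDerivAt (fun t : ℝ => (t : ℂ) ^ s) (s * (t : ℂ) ^ (s - 1)) t := by
      have := (hasDerivAt_id (t : ℂ)).cpow_const (c := s) (Or.inl (by simpa using ht.1))
      simpa using this.comp_ofReal
    have h2 : HasDerivAt (fun t : ℝ => ((1 + t) ^ n)⁻¹) (-(n * ((1 + t) ^ (n + 1))⁻¹)) t := by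
      have h3 : HasDerivAt (fun t : ℝ => (1 + t) ^ n) (n * (1 + t) ^ (n - 1) * 1) t :=
        ((hasDerivAt_id t).const_add 1).pow n
      refine (h3.fun_inv (by positivity)).congr_deriv ?_
      rcases n with _ | n
      · simp
      · rw [Nat.add_sub_cancel]
        field_simp
        ring
    refine (h1.mul h2.ofReal_comp).congr_deriv ?_
    rw [add_sub_cancel_right]
    push_cast
    ring
  have hI1 := integrableOn_unitMellin (continuousOn_inv_one_add_pow n) hs
  have hI2 := integrableOn_unitMellin (continuousOn_inv_one_add_pow (n + 1))
    (s := s + 1) (by simp; linarith)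
  have hc : ContinuousOn (fun t : ℝ => (t : ℂ) ^ s * (((1 + t) ^ n)⁻¹ : ℝ)) (Icc 0 1) := by
    refine ContinuousOn.mul ?_ (Complex.continuous_ofReal.comp_continuousOn
      (continuousOn_inv_one_add_pow n))
    exact (Complex.continuous_ofReal_cpow_const hs).continuousOn
  have key := intervalIntegral.integral_eq_sub_of_hasDerivAt_of_le zero_le_one hc hd (by
    rw [intervalIntegrable_iff_integrableOn_Ioc_of_le zero_le_one]
    exact (hI1.const_mul s).sub (hI2.const_mul (n : ℂ)))
  rw [intervalIntegral.integral_of_le zero_le_one,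
    integral_sub (hI1.const_mul s) (hI2.const_mul (n : ℂ)), integral_const_mul,
    integral_const_mul] at key
  change s * altBeta n s - n * altBeta (n + 1) (s + 1) = _ at key
  rw [sub_eq_iff_eq_add] at key
  rw [key]
  congr 1
  simp [Complex.zero_cpow h0]
  norm_num

/-- The function `1 + (s-1)(s-2) β(s)`, in the form that results from two integrations by parts.
Up to the elementary factor `2 / (s-1)` this is `g*(2-s)`. -/
noncomputable def zeroFn (s : ℂ) : ℂ := s / 2 - 1 / 4 + 2 * altBeta 3 s

lemma differentiableAt_zeroFn {s : ℂ} (hs : 0 < s.re) : DifferentiableAt ℂ zeroFn s := by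
  unfold zeroFn
  have := differentiableAt_altBeta 3 hs
  fun_prop

lemma zeroFn_eq {s : ℂ} (hs : 0 < s.re) :
    zeroFn s = 1 + (s - 1) * (s - 2) * altBeta 1 s := by
  have h1 := altBeta_split 1 hs
  have h2 := altBeta_split 2 hs
  have h3 := mul_altBeta 1 hs
  have h4 := mul_altBeta 2 hs
  norm_num at h1 h2 h3 h4
  unfold zeroFn
  linear_combination (-2 + s) * (h1 - h3) + (-2 * h2 + h4)

/-- The recurrence `β(s) + β(s+1) = 1/s`. -/
lemma altBeta_one_add {s : ℂ} (hs : 0 < s.re) : altBeta 1 s + altBeta 1 (s + 1) = 1 / s := by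
  rw [← altBeta_zero hs, altBeta_split 0 hs]

lemma zeroFn_one : zeroFn 1 = 1 := by
  rw [zeroFn_eq (by simp)]; simp

open ComplexConjugate in
lemma unitMellin_conj (f : ℝ → ℝ) (s : ℂ) : unitMellin f (conj s) = conj (unitMellin f s) := by
  unfold unitMellin
  rw [← integral_conj]
  refine setIntegral_congr_fun measurableSet_Ioc fun t ht => ?_
  simp only [map_mul, Complex.conj_ofReal]
  congr 1
  have : conj s - 1 = conj (s - 1) := by simp
  rw [this, Complex.cpow_conj, Complex.conj_ofReal]
  rw [Complex.arg_ofReal_of_nonneg ht.1.le]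
  exact Real.pi_pos.ne

open ComplexConjugate in
lemma zeroFn_conj (s : ℂ) : zeroFn (conj s) = conj (zeroFn s) := by
  unfold zeroFn altBeta
  rw [unitMellin_conj]
  simp [Complex.conj_ofNat]

lemma integral_rpow_mul_cubic {σ : ℝ} (hσ : 0 < σ) (a₀ a₁ a₂ a₃ : ℝ) :
    IntegrableOn (fun t : ℝ => t ^ (σ - 1) * (a₀ + a₁ * t + a₂ * t ^ 2 + a₃ * t ^ 3)) (Ioc 0 1) ∧
    ∫ t in Ioc (0 : ℝ) 1, t ^ (σ - 1) * (a₀ + a₁ * t + a₂ * t ^ 2 + a₃ * t ^ 3) =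
      a₀ / σ + a₁ / (σ + 1) + a₂ / (σ + 2) + a₃ / (σ + 3) := by
  have e : ∀ t ∈ Ioc (0 : ℝ) 1, t ^ (σ - 1) * (a₀ + a₁ * t + a₂ * t ^ 2 + a₃ * t ^ 3) =
      a₀ * t ^ (σ - 1) + a₁ * t ^ (σ + 1 - 1) + a₂ * t ^ (σ + 2 - 1) + a₃ * t ^ (σ + 3 - 1) := by
    intro t ht
    have h1 : t ^ (σ + 1 - 1) = t ^ (σ - 1) * t := by
      rw [← Real.rpow_add_one ht.1.ne']; ring_nf
    have h2 : t ^ (σ + 2 - 1) = t ^ (σ - 1) * t ^ 2 := by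
      rw [← Real.rpow_add_natCast ht.1.ne']; push_cast; ring_nf
    have h3 : t ^ (σ + 3 - 1) = t ^ (σ - 1) * t ^ 3 := by
      rw [← Real.rpow_add_natCast ht.1.ne']; push_cast; ring_nf
    rw [h1, h2, h3]; ring
  have i0 := (integrableOn_rpow_sub_one hσ).const_mul a₀
  have i1 := (integrableOn_rpow_sub_one (by linarith : 0 < σ + 1)).const_mul a₁
  have i2 := (integrableOn_rpow_sub_one (by linarith : 0 < σ + 2)).const_mul a₂
  have i3 := (integrableOn_rpow_sub_one (by linarith : 0 < σ + 3)).const_mul a₃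
  have i01 : IntegrableOn (fun t : ℝ => a₀ * t ^ (σ - 1) + a₁ * t ^ (σ + 1 - 1)) (Ioc 0 1) :=
    i0.add i1
  have i02 : IntegrableOn (fun t : ℝ => a₀ * t ^ (σ - 1) + a₁ * t ^ (σ + 1 - 1) +
      a₂ * t ^ (σ + 2 - 1)) (Ioc 0 1) := i01.add i2
  refine ⟨(integrableOn_congr_fun e measurableSet_Ioc).mpr (i02.add i3), ?_⟩
  rw [setIntegral_congr_fun measurableSet_Ioc e, integral_add i02 i3,
    integral_add i01 i2, integral_add i0 i1, integral_const_mul, integral_const_mul,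
    integral_const_mul, integral_const_mul, integral_rpow_sub_one hσ,
    integral_rpow_sub_one (by linarith), integral_rpow_sub_one (by linarith),
    integral_rpow_sub_one (by linarith)]
  ring

lemma integral_rpow_mul_neg_log {p : ℝ} (hp : 0 < p) :
    IntegrableOn (fun t : ℝ => t ^ (p - 1) * -Real.log t) (Ioc 0 1) ∧
    ∫ t in Ioc (0 : ℝ) 1, t ^ (p - 1) * -Real.log t = 1 / p ^ 2 := by
  set F : ℝ → ℝ := fun t => -(Real.log t * t ^ p) / p + t ^ p / p ^ 2 with hF
  have hd : ∀ t ∈ Ioo (0 : ℝ) 1, HasDerivAt F (t ^ (p - 1) * -Real.log t) t := by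
    intro t ht
    have h1 := Real.hasDerivAt_rpow_const (x := t) (p := p) (Or.inl ht.1.ne')
    have h2 := (Real.hasDerivAt_log ht.1.ne').mul h1
    refine ((h2.neg.div_const p).add (h1.div_const (p ^ 2))).congr_deriv ?_
    have : t ^ p = t ^ (p - 1) * t := by rw [← Real.rpow_add_one ht.1.ne']; ring_nf
    rw [this]
    have := ht.1.ne'
    field_simp
    ring
  have hc : ContinuousOn F (Icc 0 1) := by
    refine ContinuousOn.add (ContinuousOn.div_const (ContinuousOn.neg ?_) _) ?_
    · intro t ht
      rcases ht.1.eq_or_lt with rfl | h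
      · have := tendsto_log_mul_rpow_nhdsGT_zero hp
        refine ContinuousWithinAt.mono (t := Ici 0) ?_ Icc_subset_Ici_self
        rw [← continuousWithinAt_Ioi_iff_Ici]
        simpa [ContinuousWithinAt] using this
      · exact ((Real.continuousAt_log h.ne').mul
          (Real.continuousAt_rpow_const _ _ (Or.inl h.ne'))).continuousWithinAt
    · exact ((Real.continuous_rpow_const hp.le).continuousOn).div_const _
  have hpos : ∀ t ∈ Ioo (0 : ℝ) 1, 0 ≤ t ^ (p - 1) * -Real.log t := fun t ht =>
    mul_nonneg (Real.rpow_nonneg ht.1.le _) (by linarith [Real.log_neg ht.1 ht.2])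
  have hi := intervalIntegral.integrableOn_deriv_of_nonneg hc hd hpos
  refine ⟨hi, ?_⟩
  rw [← intervalIntegral.integral_of_le zero_le_one,
    intervalIntegral.integral_eq_sub_of_hasDerivAt_of_le zero_le_one hc hd
      ((intervalIntegrable_iff_integrableOn_Ioc_of_le zero_le_one).mpr hi)]
  simp [hF, Real.zero_rpow hp.ne']

lemma integral_rpow_neg_log_mul_cubic {σ : ℝ} (hσ : 0 < σ) (a₁ a₂ a₃ : ℝ) :
    IntegrableOn (fun t : ℝ => t ^ (σ - 1) * -Real.log t * (a₁ * t + a₂ * t ^ 2 + a₃ * t ^ 3))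
      (Ioc 0 1) ∧
    ∫ t in Ioc (0 : ℝ) 1, t ^ (σ - 1) * -Real.log t * (a₁ * t + a₂ * t ^ 2 + a₃ * t ^ 3) =
      a₁ / (σ + 1) ^ 2 + a₂ / (σ + 2) ^ 2 + a₃ / (σ + 3) ^ 2 := by
  have e : ∀ t ∈ Ioc (0 : ℝ) 1, t ^ (σ - 1) * -Real.log t * (a₁ * t + a₂ * t ^ 2 + a₃ * t ^ 3) =
      a₁ * (t ^ (σ + 1 - 1) * -Real.log t) + a₂ * (t ^ (σ + 2 - 1) * -Real.log t)
        + a₃ * (t ^ (σ + 3 - 1) * -Real.log t) := by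
    intro t ht
    have h1 : t ^ (σ + 1 - 1) = t ^ (σ - 1) * t := by
      rw [← Real.rpow_add_one ht.1.ne']; ring_nf
    have h2 : t ^ (σ + 2 - 1) = t ^ (σ - 1) * t ^ 2 := by
      rw [← Real.rpow_add_natCast ht.1.ne']; push_cast; ring_nf
    have h3 : t ^ (σ + 3 - 1) = t ^ (σ - 1) * t ^ 3 := by
      rw [← Real.rpow_add_natCast ht.1.ne']; push_cast; ring_nf
    rw [h1, h2, h3]; ring
  obtain ⟨i1, e1⟩ := integral_rpow_mul_neg_log (by linarith : 0 < σ + 1)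
  obtain ⟨i2, e2⟩ := integral_rpow_mul_neg_log (by linarith : 0 < σ + 2)
  obtain ⟨i3, e3⟩ := integral_rpow_mul_neg_log (by linarith : 0 < σ + 3)
  replace i1 := i1.const_mul a₁
  replace i2 := i2.const_mul a₂
  replace i3 := i3.const_mul a₃
  have i12 : IntegrableOn (fun t : ℝ => a₁ * (t ^ (σ + 1 - 1) * -Real.log t) +
      a₂ * (t ^ (σ + 2 - 1) * -Real.log t)) (Ioc 0 1) := i1.add i2
  refine ⟨(integrableOn_congr_fun e measurableSet_Ioc).mpr (i12.add i3), ?_⟩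
  rw [setIntegral_congr_fun measurableSet_Ioc e, integral_add i12 i3,
    integral_add i1 i2, integral_const_mul, integral_const_mul, integral_const_mul, e1, e2, e3]
  ring

/-! ### No zeros in the sector `|Im s| ≤ Re s` -/

/-- For `Re s ≥ 3/2` the term `s/2 - 1/4` of `zeroFn` dominates. -/
lemma zeroFn_ne_zero_of_three_halves_le {s : ℂ} (hs : 3 / 2 ≤ s.re) : zeroFn s ≠ 0 := by
  have hJ : ‖altBeta 3 s‖ ≤ 0.225 := by
    -- `(1+t)^(-3) ≤ 1 - 2.2 t + 2 t^2 - 0.6 t^3` on the unit interval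
    obtain ⟨hi, he⟩ := integral_rpow_mul_cubic (σ := 3 / 2) (by norm_num) 1 (-2.2) 2 (-0.6)
    refine (norm_unitMellin_le hs hi fun t ht => ?_).trans (he.trans_le (by norm_num))
    obtain ⟨h0, h1⟩ := ht
    rw [abs_of_pos (by positivity), inv_le_iff_one_le_mul₀ (by positivity)]
    have : 0 ≤ t * (1 - t) := mul_nonneg h0.le (by linarith)
    have : 0 ≤ (t - 0.6) ^ 2 * t := by positivity
    nlinarith [mul_nonneg h0.le (sq_nonneg (t - 0.6)),
      mul_nonneg (pow_pos h0 3).le (sub_nonneg.2 h1),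
      mul_nonneg (pow_pos h0 4).le (sub_nonneg.2 h1),
      mul_nonneg (pow_pos h0 2).le (sub_nonneg.2 h1),
      mul_nonneg (pow_pos h0 2).le (sq_nonneg (t - 0.6)),
      mul_nonneg (pow_pos h0 3).le (sq_nonneg (t - 0.6))]
  intro h
  have h2 := congrArg Complex.re h
  simp only [zeroFn, Complex.add_re, Complex.sub_re, Complex.mul_re, Complex.re_ofNat,
    Complex.im_ofNat, Complex.zero_re] at h2
  norm_num at h2
  have h3 := (Complex.abs_re_le_norm (altBeta 3 s)).trans hJ
  rw [abs_le] at h3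
  linarith [h3.1]

/-- A zero would give `|s| = |s-1| |s-2| |1/2 + β₂|` with `β₂ = ∫_0^1 t^s (1+t)^(-2) dt`, of modulus
less than `0.265`. -/
lemma zeroFn_ne_zero_of_abs_im_le {s : ℂ} (hs : 0.65 ≤ s.re) (him : |s.im| ≤ s.re) :
    zeroFn s ≠ 0 := by
  rcases le_or_gt (3 / 2) s.re with h | h
  · exact zeroFn_ne_zero_of_three_halves_le h
  have hpos : 0 < s.re := by linarith
  have hJ : ‖altBeta 2 (s + 1)‖ ≤ 0.265 := by
    -- `(1+t)^(-2) ≤ 1 - 1.45 t + 0.75 t^2` on the unit interval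
    obtain ⟨hi, he⟩ := integral_rpow_mul_cubic (σ := 1.65) (by norm_num) 1 (-1.45) 0.75 0
    refine (norm_unitMellin_le (by simp; linarith) hi fun t ht => ?_).trans
      (he.trans_le (by norm_num))
    obtain ⟨h0, h1⟩ := ht
    rw [abs_of_pos (by positivity), inv_le_iff_one_le_mul₀ (by positivity)]
    nlinarith [mul_nonneg h0.le (sq_nonneg (t - 0.5)),
      mul_nonneg (pow_pos h0 3).le (sub_nonneg.2 h1),
      mul_nonneg (pow_pos h0 2).le (sub_nonneg.2 h1),
      mul_nonneg (pow_pos h0 2).le (sq_nonneg (t - 0.5))]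
  intro h0
  rw [zeroFn_eq hpos] at h0
  have h1 := mul_altBeta 1 hpos
  have h2 : s * -1 = (s - 1) * (s - 2) * (1 / 2 + altBeta 2 (s + 1)) := by
    norm_num at h1
    linear_combination (-s) * h0 + (s - 1) * (s - 2) * h1
  have h3 : ‖s‖ ^ 2 ≤ ‖s - 1‖ ^ 2 * ‖s - 2‖ ^ 2 * 0.765 ^ 2 := by
    have := congrArg norm h2
    simp only [norm_mul, norm_neg, norm_one, mul_one] at this
    rw [this, ← mul_pow, ← mul_pow]
    gcongr
    refine (norm_add_le _ _).trans ?_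
    norm_num
    linarith
  rw [← Complex.normSq_eq_norm_sq, ← Complex.normSq_eq_norm_sq, ← Complex.normSq_eq_norm_sq] at h3
  simp only [Complex.normSq_apply, Complex.sub_re, Complex.sub_im, Complex.one_re, Complex.one_im,
    Complex.re_ofNat, Complex.im_ofNat, sub_zero] at h3
  set x := s.re
  set X := s.im * s.im with hX
  have hX0 : 0 ≤ X := mul_self_nonneg _
  have hX1 : X ≤ x * x := by
    have := abs_le.mp him
    nlinarith
  have hq := mul_nonneg (sub_nonneg.2 hs) (sub_nonneg.2 h.le)
  -- The difference of the two sides of `h3` is convex in `X`, so its sign is decided at the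
  -- end points `X = 0` and `X = x ^ 2`.
  have hA : 0.585225 * ((x - 1) ^ 2 * (x - 2) ^ 2) < x ^ 2 := by
    nlinarith [hq, mul_nonneg hq hpos.le, sq_nonneg (x - 1), mul_nonneg hq (sq_nonneg x)]
  have hB : 0.585225 * (((x - 1) ^ 2 + x ^ 2) * ((x - 2) ^ 2 + x ^ 2)) < x ^ 2 + x ^ 2 := by
    nlinarith [hq, mul_nonneg hq hpos.le, sq_nonneg (x - 1), mul_nonneg hq (sq_nonneg x)]
  have hXx : 0 ≤ x ^ 2 - X := by nlinarith
  have h4 : 0 ≤ X * (x ^ 2 - X) := mul_nonneg hX0 hXx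
  have hx2 : 0 < x ^ 2 := by positivity
  have h5 : 0 ≤ x ^ 2 * (X * (x ^ 2 - X)) := mul_nonneg hx2.le h4
  have h6 := mul_le_mul_of_nonneg_left h3 hx2.le
  have h7 : 0 ≤ X * (x ^ 2 + x ^ 2 - 0.585225 * (((x - 1) ^ 2 + x ^ 2) * ((x - 2) ^ 2 + x ^ 2))) :=
    mul_nonneg hX0 (by linarith)
  have h8 : 0 ≤ (x ^ 2 - X) * (x ^ 2 - 0.585225 * ((x - 1) ^ 2 * (x - 2) ^ 2)) :=
    mul_nonneg hXx (by linarith)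
  have h9 : 0 < X * (x ^ 2 + x ^ 2 - 0.585225 * (((x - 1) ^ 2 + x ^ 2) * ((x - 2) ^ 2 + x ^ 2))) +
      (x ^ 2 - X) * (x ^ 2 - 0.585225 * ((x - 1) ^ 2 * (x - 2) ^ 2)) := by
    rcases hX0.eq_or_lt with h' | h'
    · rw [← h']; nlinarith
    · have := mul_pos h' (sub_pos.2 hB); linarith
  nlinarith

/-! ### At most one zero in the sector `Re s ≤ Im s` -/

/-- The remainder of `(1+t)^(-3)` after its approximation by `1 - 1.3 t`. -/
noncomputable def cubeRemainder (t : ℝ) : ℝ := ((1 + t) ^ 3)⁻¹ - 1 + 1.3 * t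

lemma continuousOn_cubeRemainder : ContinuousOn cubeRemainder (Icc 0 1) := by
  unfold cubeRemainder
  exact ((continuousOn_inv_one_add_pow 3).sub continuousOn_const).add (by fun_prop)

lemma abs_cubeRemainder_le {t : ℝ} (h0 : 0 < t) (h1 : t ≤ 1) :
    |cubeRemainder t| ≤ 1.7 * t + -4.9 * t ^ 2 + 4 * t ^ 3 := by
  have h2 : 0 < (1 + t) ^ 3 := by positivity
  have e : ((1 + t) ^ 3)⁻¹ * (1 + t) ^ 3 = 1 := inv_mul_cancel₀ h2.ne'
  rw [abs_le, cubeRemainder]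
  generalize ((1 + t) ^ 3)⁻¹ = y at e ⊢
  constructor
  · by_contra! hc
    have h3 := mul_lt_mul_of_pos_right hc h2
    nlinarith [mul_nonneg h0.le (sq_nonneg (t - 0.5)),
      mul_nonneg (pow_pos h0 3).le (sub_nonneg.2 h1),
      mul_nonneg (pow_pos h0 2).le (sub_nonneg.2 h1),
      mul_nonneg (pow_pos h0 2).le (sq_nonneg (t - 0.5)), pow_pos h0 2, pow_pos h0 3,
      pow_pos h0 4, pow_pos h0 5, pow_pos h0 6]
  · by_contra! hc
    have h3 := mul_lt_mul_of_pos_right hc h2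
    have h4 : 0 ≤ 3.4 - 0.7 * t - 8.5 * t ^ 2 - 2.3 * t ^ 3 + 7.1 * t ^ 4 + 4 * t ^ 5 := by
      nlinarith [sq_nonneg (t - 0.73), mul_nonneg h0.le (sq_nonneg (t - 0.73)),
        mul_nonneg (pow_pos h0 2).le (sq_nonneg (t - 0.73)),
        mul_nonneg (pow_pos h0 3).le (sq_nonneg (t - 0.73))]
    have h5 := mul_nonneg h0.le h4
    have h6 : (y - 1 + 1.3 * t) * (1 + t) ^ 3 = 1 + (-1 + 1.3 * t) * (1 + t) ^ 3 := by
      linear_combination e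
    rw [h6] at h3
    linarith

lemma norm_cpow_sub_cpow_le {t σ : ℝ} (h0 : 0 < t) (h1 : t ≤ 1) {z w : ℂ} (hz : σ ≤ z.re)
    (hw : σ ≤ w.re) :
    ‖(t : ℂ) ^ (z - 1) - (t : ℂ) ^ (w - 1)‖ ≤ t ^ (σ - 1) * -Real.log t * ‖z - w‖ := by
  have ht : (t : ℂ) ≠ 0 := Complex.ofReal_ne_zero.mpr h0.ne'
  have hlog : Real.log t ≤ 0 := Real.log_nonpos h0.le h1
  refine (convex_halfSpace_re_ge σ).norm_image_sub_le_of_norm_hasDerivWithin_le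
    (f := fun z : ℂ => (t : ℂ) ^ (z - 1)) (f' := fun z => (t : ℂ) ^ (z - 1) * Complex.log t)
    (fun x _ => ?_) (fun x hx => ?_) hw hz
  · simpa using! (((hasDerivAt_id x).sub_const 1).const_cpow (Or.inl ht)).hasDerivWithinAt
  · rw [norm_mul, Complex.norm_cpow_eq_rpow_re_of_pos h0, ← Complex.ofReal_log h0.le,
      Complex.norm_real, Real.norm_eq_abs, abs_of_nonpos hlog]
    refine mul_le_mul_of_nonneg_right (Real.rpow_le_rpow_of_exponent_ge h0 h1 ?_) (by linarith)
    have : σ ≤ x.re := hx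
    simpa using this

lemma norm_unitMellin_cubeRemainder_sub_le {z w : ℂ} (hz : 0.65 ≤ z.re) (hw : 0.65 ≤ w.re) :
    ‖unitMellin cubeRemainder z - unitMellin cubeRemainder w‖ ≤ 0.2275 * ‖z - w‖ := by
  obtain ⟨hi, he⟩ := integral_rpow_neg_log_mul_cubic (σ := 0.65) (by norm_num) 1.7 (-4.9) 4
  unfold unitMellin
  rw [← integral_sub (integrableOn_unitMellin continuousOn_cubeRemainder (by linarith))
    (integrableOn_unitMellin continuousOn_cubeRemainder (by linarith))]
  refine (norm_integral_le_of_norm_le (hi.mul_const ‖z - w‖) ?_).trans ?_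
  · filter_upwards [ae_restrict_mem measurableSet_Ioc] with t ht
    rw [← sub_mul, norm_mul, Complex.norm_real, Real.norm_eq_abs]
    have h1 := norm_cpow_sub_cpow_le ht.1 ht.2 hz hw
    have h2 := abs_cubeRemainder_le ht.1 ht.2
    have h3 := (norm_nonneg _).trans h1
    calc _ ≤ _ := mul_le_mul h1 h2 (abs_nonneg _) h3
      _ = _ := by ring
  · rw [integral_mul_const, he]
    gcongr
    norm_num

lemma zeroFn_eq_rational_add {s : ℂ} (hs : 0 < s.re) :
    zeroFn s = s / 2 - 1 / 4 + 2 / s - 2.6 / (s + 1) + 2 * unitMellin cubeRemainder s := by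
  have h : altBeta 3 s = unitMellin cubeRemainder s + 1 / s + (-1.3 : ℝ) * (1 / (s + 1)) := by
    have h1 := unitMellin_pow 1 hs
    rw [Nat.cast_one] at h1
    rw [← unitMellin_one hs, ← h1, ← unitMellin_const_mul, ← unitMellin_add
      continuousOn_cubeRemainder continuousOn_const hs, ← unitMellin_add
      (f := fun t => cubeRemainder t + 1) (g := fun t => -1.3 * t ^ 1)
      (continuousOn_cubeRemainder.add continuousOn_const) (by fun_prop) hs]
    refine unitMellin_congr (fun t _ => ?_) s
    rw [cubeRemainder]; ring
  rw [zeroFn, h]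
  push_cast; ring

/-- Difference quotients of `zeroFn` are explicit up to an error less than `1/2`. -/
lemma norm_zeroFn_sub_sub_le {z w : ℂ} (hz : 0.65 ≤ z.re) (hw : 0.65 ≤ w.re) :
    ‖zeroFn z - zeroFn w - (z - w) * (1 / 2 - 2 * (1 / (z * w) - 1.3 / ((z + 1) * (w + 1))))‖ ≤
      0.455 * ‖z - w‖ := by
  have hz0 : z ≠ 0 := by rintro rfl; norm_num at hz
  have hw0 : w ≠ 0 := by rintro rfl; norm_num at hw
  have hz1 : z + 1 ≠ 0 := by
    intro h; have := congrArg Complex.re h; simp at this; linarith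
  have hw1 : w + 1 ≠ 0 := by
    intro h; have := congrArg Complex.re h; simp at this; linarith
  rw [zeroFn_eq_rational_add (by linarith), zeroFn_eq_rational_add (by linarith)]
  have e : z / 2 - 1 / 4 + 2 / z - 2.6 / (z + 1) + 2 * unitMellin cubeRemainder z -
      (w / 2 - 1 / 4 + 2 / w - 2.6 / (w + 1) + 2 * unitMellin cubeRemainder w) -
      (z - w) * (1 / 2 - 2 * (1 / (z * w) - 1.3 / ((z + 1) * (w + 1)))) =
      2 * (unitMellin cubeRemainder z - unitMellin cubeRemainder w) := by
    field_simp
    ring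
  rw [e, norm_mul]
  have := norm_unitMellin_cubeRemainder_sub_le hz hw
  norm_num
  linarith

/-- A zero of `zeroFn` of modulus at most `2` in the sector `Re s ≤ Im s`, `Re s ≥ 0.65`, is the
only zero there. For two zeros the explicit part of the difference quotient would have modulus at
most `0.455`, but its real part is at least `1/2`. -/
lemma zeroFn_zero_unique {z w : ℂ} (hz : 0.65 ≤ z.re) (hw : 0.65 ≤ w.re) (hz' : z.re ≤ z.im)
    (hw' : w.re ≤ w.im) (hzn : ‖z‖ ≤ 2) (h0 : zeroFn z = 0) (h1 : zeroFn w = 0) : z = w := by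
  by_contra hne
  have hpos : 0 < ‖z - w‖ := norm_pos_iff.mpr (sub_ne_zero.mpr hne)
  have key := norm_zeroFn_sub_sub_le hz hw
  rw [h0, h1, sub_self, zero_sub, norm_neg, norm_mul, mul_comm] at key
  have key2 := (Complex.re_le_norm _).trans (le_of_mul_le_mul_right key hpos)
  have hre : (1 / (z * w) - 1.3 / ((z + 1) * (w + 1))).re ≤ 0 := by
    set X := z.im * w.im - z.re * w.re with hX
    have hX0 : 0 ≤ X := by rw [hX]; nlinarith
    have hN : 0 < Complex.normSq (z * w) := Complex.normSq_pos.mpr (by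
      refine mul_ne_zero ?_ ?_
      · rintro rfl; norm_num at hz
      · rintro rfl; norm_num at hw)
    have hz2 : 1.3 * Complex.normSq z ≤ Complex.normSq (z + 1) := by
      have h2 : Complex.normSq z ≤ 4 := by
        rw [Complex.normSq_eq_norm_sq]; nlinarith [norm_nonneg z]
      rw [Complex.normSq_apply] at h2 ⊢
      simp only [Complex.normSq_apply, Complex.add_re, Complex.add_im, Complex.one_re,
        Complex.one_im]
      nlinarith
    have hw2 : Complex.normSq w ≤ Complex.normSq (w + 1) := by
      simp only [Complex.normSq_apply, Complex.add_re, Complex.add_im, Complex.one_re,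
        Complex.one_im]
      nlinarith
    have hM : 1.3 * Complex.normSq (z * w) ≤ Complex.normSq ((z + 1) * (w + 1)) := by
      rw [Complex.normSq_mul, Complex.normSq_mul, ← mul_assoc]
      exact mul_le_mul hz2 hw2 (Complex.normSq_nonneg _) (Complex.normSq_nonneg _)
    have e1 : (1 / (z * w)).re = -X / Complex.normSq (z * w) := by
      rw [one_div, Complex.inv_re, Complex.mul_re, hX]; ring
    have e2 : (1.3 / ((z + 1) * (w + 1))).re =
        1.3 * ((z.re + 1) * (w.re + 1) - z.im * w.im) / Complex.normSq ((z + 1) * (w + 1)) := by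
      have : (1.3 : ℂ) = ((1.3 : ℝ) : ℂ) := by norm_num
      rw [this, div_eq_mul_inv, Complex.re_ofReal_mul, Complex.inv_re, Complex.mul_re]
      simp only [Complex.add_re, Complex.add_im, Complex.one_re, Complex.one_im, add_zero]
      ring
    rw [Complex.sub_re, e1, e2]
    have h3 : -X / Complex.normSq (z * w) ≤ 1.3 * -X / Complex.normSq ((z + 1) * (w + 1)) := by
      rw [div_le_div_iff₀ hN (by linarith)]
      nlinarith
    refine sub_nonpos.mpr (h3.trans ?_)
    gcongr
    · linarith
    · nlinarith
  simp only [Complex.sub_re, Complex.mul_re] at key2 hre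
  norm_num at key2 hre
  linarith

/-! ### Existence and numerical location of a zero -/

/-- `(1+t)^n ≥ 2^n t^(n/2)` turns into a bound for `altBeta` that is sharp to first order. -/
lemma norm_altBeta_le_two_pow (n : ℕ) {s : ℂ} (hs : n / 2 < s.re) :
    ‖altBeta n s‖ ≤ 1 / (2 ^ n * (s.re - n / 2)) := by
  have hi : IntegrableOn (fun t : ℝ => t ^ (s.re - n / 2 - 1) * (1 / 2 ^ n)) (Ioc 0 1) :=
    (integrableOn_rpow_sub_one (by linarith)).mul_const _
  have he : ∀ t ∈ Ioc (0 : ℝ) 1, t ^ (s.re - n / 2 - 1) * (1 / 2 ^ n) =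
      t ^ (s.re - 1) * (t ^ (-(n / 2 : ℝ)) * (1 / 2 ^ n)) := fun t ht => by
    rw [← mul_assoc, ← Real.rpow_add ht.1]
    ring_nf
  refine (norm_unitMellin_le le_rfl ((integrableOn_congr_fun he measurableSet_Ioc).mp hi)
    fun t ht => ?_).trans ?_
  · rw [abs_of_pos (by have := ht.1; positivity), Real.rpow_neg ht.1.le, one_div, ← mul_inv]
    have h0 := ht.1
    refine inv_anti₀ (by positivity) ?_
    have h1 : t ^ (n / 2 : ℝ) = (t ^ (1 / 2 : ℝ)) ^ n := by
      rw [← Real.rpow_natCast, ← Real.rpow_mul h0.le]; ring_nf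
    rw [h1, ← mul_pow]
    have h2 : t ^ (1 / 2 : ℝ) * t ^ (1 / 2 : ℝ) = t := by
      rw [← Real.rpow_add h0]; norm_num
    refine pow_le_pow_left₀ (by positivity) ?_ n
    nlinarith [sq_nonneg (t ^ (1 / 2 : ℝ) - 1)]
  · rw [← setIntegral_congr_fun measurableSet_Ioc he, integral_mul_const,
      integral_rpow_sub_one (by linarith)]
    exact le_of_eq (by field_simp)

lemma altBeta_one_add_eight {s : ℂ} (hs : 0 < s.re) :
    altBeta 1 s = s⁻¹ - (s + 1)⁻¹ + (s + 2)⁻¹ - (s + 3)⁻¹ + (s + 4)⁻¹ - (s + 5)⁻¹ + (s + 6)⁻¹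
      - (s + 7)⁻¹ + altBeta 1 (s + 8) := by
  have h : ∀ n : ℕ, altBeta 1 (s + n) + altBeta 1 (s + (n + 1 : ℕ)) = (s + n)⁻¹ := fun n => by
    have := altBeta_one_add (s := s + n) (by simp; positivity)
    rw [← one_div, ← this]; push_cast; ring_nf
  have h0 := h 0; have h1 := h 1; have h2 := h 2; have h3 := h 3
  have h4 := h 4; have h5 := h 5; have h6 := h 6; have h7 := h 7
  norm_num at h0 h1 h2 h3 h4 h5 h6 h7
  linear_combination h0 - h1 + h2 - h3 + h4 - h5 + h6 - h7

/-- Four steps of integration by parts (the Euler transform of the alternating series). -/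
lemma altBeta_one_euler {s : ℂ} (hs : 0 < s.re) :
    altBeta 1 s = s⁻¹ * (1 / 2 + (s + 1)⁻¹ * (1 / 4 + (s + 2)⁻¹ * (1 / 4 + (s + 3)⁻¹ * (3 / 8))))
      + s⁻¹ * (s + 1)⁻¹ * (s + 2)⁻¹ * (s + 3)⁻¹ * (24 * altBeta 5 (s + 4)) := by
  have e : ∀ (n : ℕ) (k : ℕ), altBeta n (s + k) =
      (s + k)⁻¹ * (1 / 2 ^ n + n * altBeta (n + 1) (s + (k + 1 : ℕ))) := fun n k => by
    have hre : 0 < (s + k).re := by simp; positivity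
    have h0 : s + k ≠ 0 := fun h => by rw [h] at hre; simp at hre
    rw [eq_inv_mul_iff_mul_eq₀ h0, mul_altBeta n hre]
    push_cast; ring_nf
  have h1 := e 1 0; have h2 := e 2 1; have h3 := e 3 2; have h4 := e 4 3
  norm_num at h1 h2 h3 h4
  rw [h1, h2, h3, h4]
  ring

/-- Evaluation of `zeroFn` near its zero: eight terms of the alternating series for the beta
function, then four terms of the Euler transform. -/
lemma norm_zeroFn_approx_le : ‖zeroFn ⟨0.653484, 1.05516⟩‖ ≤ 2.9e-5 := by
  set s : ℂ := ⟨0.653484, 1.05516⟩ with hs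
  have hre : s.re = 0.653484 := rfl
  have hn8 : 0 < (s + 8).re := by simp [hre]; norm_num
  rw [zeroFn_eq (by rw [hre]; norm_num), altBeta_one_add_eight (by rw [hre]; norm_num),
    altBeta_one_euler hn8]
  have hnum : ∀ k : ℕ, s + k = ⟨0.653484 + k, 1.05516⟩ := fun k => by
    apply Complex.ext <;> simp [hs]
  have hinv : ∀ k : ℕ, (s + k)⁻¹ = ⟨(0.653484 + k) / ((0.653484 + k) ^ 2 + 1.05516 ^ 2),
      -1.05516 / ((0.653484 + k) ^ 2 + 1.05516 ^ 2)⟩ := fun k => by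
    rw [hnum]
    apply Complex.ext <;> simp [Complex.normSq_apply, pow_two]
  have hninv : ∀ k : ℕ, ‖(s + k)⁻¹‖ ≤ ((0.653484 : ℝ) + k)⁻¹ := fun k => by
    rw [norm_inv]
    refine inv_anti₀ (by positivity) ?_
    refine le_trans (le_of_eq ?_) (Complex.re_le_norm _)
    simp [hre]
  have i0 := hinv 0; have i1 := hinv 1; have i2 := hinv 2; have i3 := hinv 3
  have i4 := hinv 4; have i5 := hinv 5; have i6 := hinv 6; have i7 := hinv 7
  have i8 := hinv 8; have i9 := hinv 9; have i10 := hinv 10; have i11 := hinv 11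
  have n8 := hninv 8; have n9 := hninv 9; have n10 := hninv 10; have n11 := hninv 11
  have hJ : ‖altBeta 5 (s + 12)‖ ≤ 0.0031 :=
    (norm_altBeta_le_two_pow 5 (by simp [hre]; norm_num)).trans (by simp [hre]; norm_num)
  have hs12 : ‖(s - 1) * (s - 2)‖ ≤ 1.91 := by
    refine (pow_le_pow_iff_left₀ (norm_nonneg _) (by norm_num) two_ne_zero).mp ?_
    rw [← Complex.normSq_eq_norm_sq, Complex.normSq_mul]
    simp [hs, Complex.normSq_apply]; norm_num
  norm_num at i0 i1 i2 i3 i4 i5 i6 i7 i8 i9 i10 i11 n8 n9 n10 n11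
  have a1 : s + 8 + 1 = s + 9 := by ring
  have a2 : s + 8 + 2 = s + 10 := by ring
  have a3 : s + 8 + 3 = s + 11 := by ring
  have a4 : s + 8 + 4 = s + 12 := by ring
  rw [a1, a2, a3, a4, ← add_assoc, mul_add ((s - 1) * (s - 2)), ← add_assoc]
  have herr : ‖(s - 1) * (s - 2) * ((s + 8)⁻¹ * (s + 9)⁻¹ * (s + 10)⁻¹ * (s + 11)⁻¹ *
      (24 * altBeta 5 (s + 12)))‖ ≤ 1.5e-5 := by
    rw [norm_mul, norm_mul _ (24 * _), norm_mul _ (s + 11)⁻¹, norm_mul _ (s + 10)⁻¹,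
      norm_mul _ (s + 9)⁻¹, norm_mul 24, norm_inv, norm_inv, norm_inv, norm_inv]
    refine (mul_le_mul hs12 (mul_le_mul (mul_le_mul (mul_le_mul (mul_le_mul n8 n9 (by positivity)
      (by norm_num)) n10 (by positivity) (by norm_num)) n11 (by positivity) (by norm_num))
      (mul_le_mul_of_nonneg_left hJ (norm_nonneg _)) (by positivity) (by norm_num))
      (by positivity) (by norm_num)).trans ?_
    norm_num
  have hmain : ‖1 + (s - 1) * (s - 2) * (s⁻¹ - (s + 1)⁻¹ + (s + 2)⁻¹ - (s + 3)⁻¹ + (s + 4)⁻¹ -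
      (s + 5)⁻¹ + (s + 6)⁻¹ - (s + 7)⁻¹ + (s + 8)⁻¹ * (1 / 2 + (s + 9)⁻¹ *
      (1 / 4 + (s + 10)⁻¹ * (1 / 4 + (s + 11)⁻¹ * (3 / 8)))))‖ ≤ 1.4e-5 := by
    rw [i0, i1, i2, i3, i4, i5, i6, i7, i8, i9, i10, i11]
    have e1 : s - 1 = ⟨-0.346516, 1.05516⟩ := by apply Complex.ext <;> simp [hs]; norm_num
    have e2 : s - 2 = ⟨-1.346516, 1.05516⟩ := by apply Complex.ext <;> simp [hs]; norm_num
    have c1 : (1 : ℂ) = ⟨1, 0⟩ := rfl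
    have c2 : (1 / 2 : ℂ) = ⟨1 / 2, 0⟩ := by apply Complex.ext <;> simp
    have c4 : (1 / 4 : ℂ) = ⟨1 / 4, 0⟩ := by apply Complex.ext <;> simp
    have c8 : (3 / 8 : ℂ) = ⟨3 / 8, 0⟩ := by apply Complex.ext <;> simp
    have hm : ∀ a b c d : ℝ, (⟨a, b⟩ * ⟨c, d⟩ : ℂ) = ⟨a * c - b * d, a * d + b * c⟩ :=
      fun a b c d => rfl
    have ha : ∀ a b c d : ℝ, (⟨a, b⟩ + ⟨c, d⟩ : ℂ) = ⟨a + c, b + d⟩ := fun a b c d => rfl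
    have hsub : ∀ a b c d : ℝ, (⟨a, b⟩ - ⟨c, d⟩ : ℂ) = ⟨a - c, b - d⟩ := fun a b c d => rfl
    rw [e1, e2, c2, c4, c8, c1]
    refine (pow_le_pow_iff_left₀ (norm_nonneg _) (by norm_num) two_ne_zero).mp ?_
    rw [← Complex.normSq_eq_norm_sq]
    simp only [hm, ha, hsub, Complex.normSq_mk]
    norm_num
  exact (norm_add_le _ _).trans ((add_le_add hmain herr).trans (by norm_num))

/-- The zero of `zeroFn` in the upper half-plane, located to within `3.3e-5` as the fixed
point of the simplified Newton iteration `z ↦ z - κ⁻¹ zeroFn z`. -/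
lemma exists_zeroFn_eq_zero :
    ∃ z : ℂ, zeroFn z = 0 ∧ ‖z - ⟨0.653484, 1.05516⟩‖ ≤ 3.3e-5 := by
  set a : ℂ := ⟨0.653484, 1.05516⟩ with ha
  -- an approximation of the explicit part of the derivative at `a`
  set κ : ℂ := ⟨1.36, 0.55⟩ with hκ
  have hκn : 1.46 ≤ ‖κ‖ := by
    refine (pow_le_pow_iff_left₀ (by norm_num) (norm_nonneg _) two_ne_zero).mp ?_
    rw [← Complex.normSq_eq_norm_sq, hκ, Complex.normSq_mk]; norm_num
  have hκ0 : κ ≠ 0 := norm_pos_iff.mp (by linarith)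
  set T : ℂ → ℂ := fun z => z - κ⁻¹ * zeroFn z with hT
  set D := Metric.closedBall a 3.3e-5 with hD
  have hDre : ∀ z ∈ D, |z.re - 0.653484| ≤ 3.3e-5 ∧ |z.im - 1.05516| ≤ 3.3e-5 := fun z hz => by
    rw [hD, Metric.mem_closedBall, dist_eq_norm] at hz
    exact ⟨(Complex.abs_re_le_norm (z - a)).trans hz, (Complex.abs_im_le_norm (z - a)).trans hz⟩
  have hderiv : ∀ z ∈ D, ∀ w ∈ D,
      ‖1 / 2 - 2 * (1 / (z * w) - 1.3 / ((z + 1) * (w + 1))) - κ‖ ≤ 0.005 := by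
    intro z hz w hw
    have hnear : ∀ b x y : ℂ, ‖b‖ ≤ 2 → 1 ≤ ‖b‖ → ‖x - b‖ ≤ 3.3e-5 → ‖y - b‖ ≤ 3.3e-5 →
        1 ≤ ‖x‖ → 1 ≤ ‖y‖ → ‖1 / (x * y) - 1 / (b * b)‖ ≤ 2e-4 := by
      intro b x y hb hb1 hx hy hx1 hy1
      have hb0 : b ≠ 0 := norm_pos_iff.mp (by linarith)
      have hx0 : x ≠ 0 := norm_pos_iff.mp (by linarith)
      have hy0 : y ≠ 0 := norm_pos_iff.mp (by linarith)
      have e : 1 / (x * y) - 1 / (b * b) =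
          -((x - b) * (y - b) + b * (x - b) + b * (y - b)) / (x * y * (b * b)) := by
        field_simp
        ring
      rw [e, norm_div, norm_neg, div_le_iff₀ (norm_pos_iff.mpr
        (mul_ne_zero (mul_ne_zero hx0 hy0) (mul_ne_zero hb0 hb0)))]
      have hden : 1 ≤ ‖x * y * (b * b)‖ := by
        rw [norm_mul, norm_mul, norm_mul]
        exact one_le_mul_of_one_le_of_one_le (one_le_mul_of_one_le_of_one_le hx1 hy1)
          (one_le_mul_of_one_le_of_one_le hb1 hb1)
      have hnum : ‖(x - b) * (y - b) + b * (x - b) + b * (y - b)‖ ≤ 1.5e-4 := by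
        refine (norm_add₃_le).trans ?_
        rw [norm_mul, norm_mul, norm_mul]
        nlinarith [norm_nonneg (x - b), norm_nonneg (y - b), norm_nonneg b]
      linarith
    have him : ∀ x ∈ D, 1 ≤ ‖x‖ ∧ 1 ≤ ‖x + 1‖ := fun x hx => by
      have h1 := abs_le.mp (hDre x hx).2
      have h2 : 1 ≤ x.im := by linarith [h1.1]
      refine ⟨h2.trans (Complex.im_le_norm x), h2.trans ?_⟩
      simpa using Complex.im_le_norm (x + 1)
    have haa : ‖a‖ ≤ 2 ∧ ‖a + 1‖ ≤ 2 := by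
      constructor <;> refine (pow_le_pow_iff_left₀ (norm_nonneg _) (by norm_num) two_ne_zero).mp ?_
      · rw [← Complex.normSq_eq_norm_sq, ha, Complex.normSq_mk]; norm_num
      · rw [← Complex.normSq_eq_norm_sq, ha]; simp [Complex.normSq_apply]; norm_num
    have haD := him a (Metric.mem_closedBall_self (by norm_num))
    have hz' := hz
    have hw' := hw
    rw [hD, Metric.mem_closedBall, dist_eq_norm] at hz' hw'
    have n1 := hnear a z w haa.1 haD.1 hz' hw' (him z hz).1 (him w hw).1
    have n2 := hnear (a + 1) (z + 1) (w + 1) haa.2 haD.2 (by simpa using hz') (by simpa using hw')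
      (him z hz).2 (him w hw).2
    have n3 : ‖1 / 2 - 2 * (1 / (a * a) - 1.3 * (1 / ((a + 1) * (a + 1)))) - κ‖ ≤ 0.004 := by
      have i0 : a⁻¹ = ⟨0.653484 / (0.653484 ^ 2 + 1.05516 ^ 2),
          -1.05516 / (0.653484 ^ 2 + 1.05516 ^ 2)⟩ := by
        apply Complex.ext <;> simp [ha, Complex.normSq_apply, pow_two]
      have i1 : (a + 1)⁻¹ = ⟨1.653484 / (1.653484 ^ 2 + 1.05516 ^ 2),
          -1.05516 / (1.653484 ^ 2 + 1.05516 ^ 2)⟩ := by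
        apply Complex.ext <;> simp [ha, Complex.normSq_apply, pow_two] <;> norm_num
      refine (Complex.norm_le_abs_re_add_abs_im _).trans ?_
      have c : (1.3 : ℂ) = ((1.3 : ℝ) : ℂ) := by norm_num
      rw [one_div (a * a), one_div ((a + 1) * (a + 1)), mul_inv, mul_inv, i0, i1, hκ, c]
      simp only [Complex.sub_re, Complex.sub_im, Complex.mul_re, Complex.mul_im, Complex.re_ofNat,
        Complex.im_ofNat]
      norm_num [abs_le]
    have e : 1 / 2 - 2 * (1 / (z * w) - 1.3 / ((z + 1) * (w + 1))) - κ =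
        (1 / 2 - 2 * (1 / (a * a) - 1.3 * (1 / ((a + 1) * (a + 1)))) - κ)
        + (-2) * (1 / (z * w) - 1 / (a * a))
        + 2.6 * (1 / ((z + 1) * (w + 1)) - 1 / ((a + 1) * (a + 1))) := by
      ring
    rw [e]
    refine norm_add₃_le.trans ?_
    rw [norm_mul, norm_mul]
    norm_num at n1 n2 n3 ⊢
    linarith
  have hlip : ∀ z ∈ D, ∀ w ∈ D, ‖T z - T w‖ ≤ 0.32 * ‖z - w‖ := by
    intro z hz w hw
    obtain ⟨hz1, hz2⟩ := hDre z hz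
    obtain ⟨hw1, hw2⟩ := hDre w hw
    have h1 := norm_zeroFn_sub_sub_le (z := z) (w := w)
      (by have := abs_le.mp hz1; linarith [this.1]) (by have := abs_le.mp hw1; linarith [this.1])
    have h2 := hderiv z hz w hw
    set Δ := 1 / 2 - 2 * (1 / (z * w) - 1.3 / ((z + 1) * (w + 1)))
    have e : T z - T w = -(κ⁻¹ * ((zeroFn z - zeroFn w - (z - w) * Δ) + (z - w) * (Δ - κ))) := by
      simp only [hT]
      field_simp
      ring
    rw [e, norm_neg, norm_mul, norm_inv, inv_mul_le_iff₀ (by linarith)]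
    refine (norm_add_le _ _).trans ?_
    rw [norm_mul]
    nlinarith [norm_nonneg (z - w)]
  have hTa : ‖T a - a‖ ≤ 2e-5 := by
    have : T a - a = -(κ⁻¹ * zeroFn a) := by simp only [hT]; ring
    rw [this, norm_neg, norm_mul, norm_inv, inv_mul_le_iff₀ (by linarith)]
    have := norm_zeroFn_approx_le
    rw [← ha] at this
    linarith
  have haD : a ∈ D := Metric.mem_closedBall_self (by norm_num)
  have hmaps : MapsTo T D D := fun z hz => by
    rw [hD, Metric.mem_closedBall, dist_eq_norm]
    have h1 := hlip z hz a haD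
    rw [hD, Metric.mem_closedBall, dist_eq_norm] at hz
    have e : T z - a = (T z - T a) + (T a - a) := by ring
    rw [e]
    refine (norm_add_le _ _).trans ?_
    linarith
  have hcon : ContractingWith 0.32 (hmaps.restrict T D D) := by
    refine ⟨by rw [← NNReal.coe_lt_coe]; norm_num, LipschitzWith.of_dist_le_mul fun z w => ?_⟩
    have := hlip z z.2 w w.2
    rw [← dist_eq_norm, ← dist_eq_norm] at this
    simpa [Subtype.dist_eq] using this
  obtain ⟨z, hz, hfix, -⟩ := hcon.exists_fixedPoint' (f := T)
    Metric.isClosed_closedBall.isComplete hmaps haD (edist_ne_top _ _)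
  refine ⟨z, ?_, by rwa [Metric.mem_closedBall, dist_eq_norm] at hz⟩
  have h1 : z - κ⁻¹ * zeroFn z = z := hfix
  have h2 : κ⁻¹ * zeroFn z = 0 := by linear_combination -h1
  exact (mul_eq_zero.mp h2).resolve_left (inv_ne_zero hκ0)

open ComplexConjugate in
/-- The rightmost zeros of `zeroFn` are a pair of complex conjugates with real part close to
`2 - 1.3465`. -/
lemma exists_rightmost_zero :
    ∃ z₀ : ℂ, zeroFn z₀ = 0 ∧ |z₀.re - 0.653484| ≤ 3.3e-5 ∧
      ∀ s : ℂ, z₀.re < s.re → zeroFn s ≠ 0 := by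
  obtain ⟨z, hz, hza⟩ := exists_zeroFn_eq_zero
  have hre : |z.re - 0.653484| ≤ 3.3e-5 :=
    (Complex.abs_re_le_norm (z - ⟨0.653484, 1.05516⟩)).trans hza
  have him : |z.im - 1.05516| ≤ 3.3e-5 :=
    (Complex.abs_im_le_norm (z - ⟨0.653484, 1.05516⟩)).trans hza
  have hre' := abs_le.mp hre
  have him' := abs_le.mp him
  have hzn : ‖z‖ ≤ 2 := by
    refine (Complex.norm_le_abs_re_add_abs_im z).trans ?_
    rw [abs_of_pos (by linarith [hre'.1]), abs_of_pos (by linarith [him'.1])]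
    linarith [hre'.2, him'.2]
  have hup : ∀ s : ℂ, z.re < s.re → 0 ≤ s.im → zeroFn s ≠ 0 := by
    intro s hs h0 h
    rcases le_or_gt s.im s.re with h1 | h1
    · exact zeroFn_ne_zero_of_abs_im_le (by linarith [hre'.1]) (by rwa [abs_of_nonneg h0]) h
    · have := zeroFn_zero_unique (by linarith [hre'.1]) (by linarith [hre'.1])
        (by linarith [hre'.2, him'.1]) h1.le hzn hz h
      rw [this] at hs
      exact lt_irrefl _ hs
  refine ⟨z, hz, hre, fun s hs h => ?_⟩
  rcases le_total 0 s.im with h0 | h0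
  · exact hup s hs h0 h
  · refine hup (conj s) (by simpa using hs) (by simpa using h0) ?_
    rw [zeroFn_conj, h, map_zero]

/-! ### The digamma function and the beta function -/

lemma digamma_ofReal {x : ℝ} (hx : 0 < x) :
    Complex.digamma (x : ℂ) = ((deriv (Real.log ∘ Real.Gamma) x : ℝ) : ℂ) := by
  have hG : ∀ m : ℕ, x ≠ -(m : ℝ) := fun m h => by
    have : (0 : ℝ) ≤ m := Nat.cast_nonneg m
    linarith
  have hGc : ∀ m : ℕ, (x : ℂ) ≠ -(m : ℂ) := fun m h => hG m (by exact_mod_cast h)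
  have h1 := (Real.differentiableAt_Gamma hG).hasDerivAt
  have h2 := (Complex.differentiableAt_Gamma _ hGc).hasDerivAt.comp_ofReal
  have h3 := h1.ofReal_comp
  simp only [Complex.Gamma_ofReal] at h2
  rw [Complex.digamma_def, logDeriv_apply, h2.unique h3, Complex.Gamma_ofReal,
    ← Complex.ofReal_div]
  exact congrArg _ (h1.log (Real.Gamma_pos_of_pos hx).ne').deriv.symm

lemma deriv_log_Gamma_add_one {x : ℝ} (hx : 0 < x) :
    deriv (Real.log ∘ Real.Gamma) (x + 1) = deriv (Real.log ∘ Real.Gamma) x + x⁻¹ := by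
  have h := Complex.digamma_apply_add_one (x : ℂ) fun m h => by
    have h' : x = -(m : ℝ) := by exact_mod_cast h
    have : (0 : ℝ) ≤ m := Nat.cast_nonneg m
    linarith
  have e : (x : ℂ) + 1 = ((x + 1 : ℝ) : ℂ) := by push_cast; rfl
  rw [e, digamma_ofReal hx, digamma_ofReal (by linarith)] at h
  exact_mod_cast h

lemma monotoneOn_deriv_log_Gamma : MonotoneOn (deriv (Real.log ∘ Real.Gamma)) (Ioi 0) := by
  refine Real.convexOn_log_Gamma.monotoneOn_deriv fun x hx => ?_
  refine DifferentiableAt.log (Real.differentiableAt_Gamma fun m h => ?_)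
    (Real.Gamma_pos_of_pos hx).ne'
  have : (0 : ℝ) ≤ m := Nat.cast_nonneg m
  have : (0 : ℝ) < x := hx
  linarith

/-- The digamma function is nondecreasing on the positive reals and grows by `1/x` between `x` and
`x + 1`. -/
lemma norm_digamma_sub_digamma_le {x : ℝ} (hx : 0 < x) :
    ‖Complex.digamma (((x : ℂ) + 1) / 2) - Complex.digamma ((x : ℂ) / 2)‖ ≤ 2 / x := by
  have e1 : ((x : ℂ) + 1) / 2 = (((x + 1) / 2 : ℝ) : ℂ) := by push_cast; rfl
  have e2 : (x : ℂ) / 2 = ((x / 2 : ℝ) : ℂ) := by push_cast; rfl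
  rw [e1, e2, digamma_ofReal (by linarith), digamma_ofReal (by linarith), ← Complex.ofReal_sub,
    Complex.norm_real, Real.norm_eq_abs, abs_le]
  have m1 := monotoneOn_deriv_log_Gamma (a := x / 2) (b := (x + 1) / 2)
    (mem_Ioi.2 (by linarith)) (mem_Ioi.2 (by linarith)) (by linarith)
  have m2 := monotoneOn_deriv_log_Gamma (a := (x + 1) / 2) (b := x / 2 + 1)
    (mem_Ioi.2 (by linarith)) (mem_Ioi.2 (by linarith)) (by linarith)
  rw [deriv_log_Gamma_add_one (by linarith), inv_div] at m2
  have : 0 < 2 / x := by positivity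
  constructor <;> linarith

lemma differentiableOn_digamma : DifferentiableOn ℂ Complex.digamma {s : ℂ | 0 < s.re} := by
  have hopen : IsOpen {s : ℂ | 0 < s.re} := isOpen_lt continuous_const Complex.continuous_re
  have hne : ∀ s ∈ {s : ℂ | 0 < s.re}, ∀ m : ℕ, s ≠ -(m : ℂ) := fun s hs m h => by
    have h1 : 0 < s.re := hs
    rw [h] at h1
    simp at h1
    have : (0 : ℝ) ≤ m := Nat.cast_nonneg m
    linarith
  have hG : DifferentiableOn ℂ Complex.Gamma {s : ℂ | 0 < s.re} := fun s hs =>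
    (Complex.differentiableAt_Gamma s (hne s hs)).differentiableWithinAt
  exact (hG.deriv hopen).div hG fun s hs => Complex.Gamma_ne_zero (hne s hs)

/-- `β(w) = ½ (ψ((w+1)/2) - ψ(w/2))`: the difference of the two sides is `2`-periodic and tends to
zero along the positive reals. -/
lemma digamma_sub_digamma_eq {w : ℂ} (hw : 0 < w.re) :
    Complex.digamma ((w + 1) / 2) - Complex.digamma (w / 2) = 2 * altBeta 1 w := by
  set U : Set ℂ := {s : ℂ | 0 < s.re} with hU
  have hopen : IsOpen U := isOpen_lt continuous_const Complex.continuous_re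
  set d : ℂ → ℂ := fun w => Complex.digamma ((w + 1) / 2) - Complex.digamma (w / 2) -
    2 * altBeta 1 w with hd
  have hanti : ∀ s ∈ U, d (s + 1) = -d s := fun s hs => by
    have h1 : Complex.digamma (s / 2 + 1) = Complex.digamma (s / 2) + (s / 2)⁻¹ :=
      Complex.digamma_apply_add_one _ fun m h => by
        have h1 : 0 < s.re := hs
        have h2 : s = -(2 * m : ℝ) := by push_cast; linear_combination 2 * h
        rw [h2] at h1
        simp at h1
        have : (0 : ℝ) ≤ m := Nat.cast_nonneg m
        linarith
    have h2 := altBeta_one_add hs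
    have e : (s + 1 + 1) / 2 = s / 2 + 1 := by ring
    simp only [hd]
    rw [e, h1, inv_div]
    linear_combination (-2) * h2
  have hper : ∀ s ∈ U, ∀ n : ℕ, d (s + 2 * n) = d s := fun s hs n => by
    induction n with
    | zero => simp
    | succ n ih =>
      have h1 : s + 2 * n ∈ U := by
        have h1 : 0 < s.re := hs
        simp only [hU, mem_ofPred_eq, Complex.add_re, Complex.mul_re, Complex.re_ofNat,
          Complex.natCast_re, Complex.im_ofNat, Complex.natCast_im]
        norm_num; positivity
      have h2 : s + 2 * n + 1 ∈ U := by
        simp only [hU, mem_ofPred_eq, Complex.add_re, Complex.one_re] at h1 ⊢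
        linarith
      have e : s + 2 * ((n + 1 : ℕ) : ℂ) = s + 2 * n + 1 + 1 := by push_cast; ring
      rw [e, hanti _ h2, hanti _ h1, neg_neg, ih]
  have hreal : ∀ x : ℝ, 0 < x → d x = 0 := fun x hx => by
    have hb : ∀ n : ℕ, ‖d x‖ ≤ 4 / (x + 2 * n) := fun n => by
      have hpos : 0 < x + 2 * n := by positivity
      have e : (x : ℂ) + 2 * n = ((x + 2 * n : ℝ) : ℂ) := by push_cast; rfl
      rw [← hper x (by simpa [hU] using hx) n, e]
      refine (norm_sub_le _ _).trans ?_
      have h1 := norm_digamma_sub_digamma_le hpos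
      have h2 := norm_altBeta_le 1 (s := ((x + 2 * n : ℝ) : ℂ)) (by simpa using hpos)
      rw [Complex.ofReal_re] at h2
      rw [norm_mul, Complex.norm_ofNat]
      calc _ ≤ 2 / (x + 2 * n) + 2 * (1 / (x + 2 * n)) := by gcongr
        _ = _ := by ring
    have hlim : Tendsto (fun n : ℕ => 4 / (x + 2 * n)) atTop (𝓝 0) := by
      refine Tendsto.const_div_atTop ?_ _
      refine tendsto_atTop_add_const_left _ _ ?_
      exact tendsto_natCast_atTop_atTop.const_mul_atTop two_pos
    exact norm_le_zero_iff.mp (ge_of_tendsto' hlim hb)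
  have hdiff : DifferentiableOn ℂ d U := by
    refine (DifferentiableOn.sub ?_ ?_).sub ?_
    · refine differentiableOn_digamma.comp (by fun_prop) fun s hs => ?_
      have h1 : 0 < s.re := hs
      simp; linarith
    · refine differentiableOn_digamma.comp (by fun_prop) fun s hs => ?_
      have h1 : 0 < s.re := hs
      simpa using h1
    · exact fun s hs => ((differentiableAt_altBeta 1 hs).const_mul 2).differentiableWithinAt
  have hpre : IsPreconnected U := (convex_halfSpace_re_gt 0).isPreconnected
  have hfreq : ∃ᶠ s in 𝓝[≠] (1 : ℂ), d s = 0 := by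
    have ht : Tendsto (fun x : ℝ => (x : ℂ)) (𝓝[≠] 1) (𝓝[≠] 1) := by
      refine tendsto_nhdsWithin_iff.mpr ⟨?_, ?_⟩
      · have := Complex.continuous_ofReal.tendsto 1
        rw [Complex.ofReal_one] at this
        exact this.mono_left nhdsWithin_le_nhds
      · filter_upwards [self_mem_nhdsWithin] with x hx
        simpa using hx
    refine ht.frequently (Eventually.frequently ?_)
    filter_upwards [nhdsWithin_le_nhds (lt_mem_nhds (zero_lt_one' ℝ))] with x hx
    exact hreal x hx
  have := (hdiff.analyticOnNhd hopen).eqOn_zero_of_preconnected_of_frequently_eq_zero hpre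
    (by simp [hU] : (1 : ℂ) ∈ U) hfreq hw
  exact sub_eq_zero.mp this

/-! ### The zeros of `gStar` -/

lemma meromorphic_gStar : Meromorphic gStar := fun z => by
  have h1 : MeromorphicAt (fun z : ℂ => Complex.digamma (-z / 2)) z :=
    (Complex.meromorphic_digamma _).comp_analyticAt (by fun_prop)
  have h2 : MeromorphicAt (fun z : ℂ => Complex.digamma ((1 - z) / 2)) z :=
    (Complex.meromorphic_digamma _).comp_analyticAt (by fun_prop)
  exact (MeromorphicAt.id z).mul (h1.sub h2)

lemma gStar_eq_of_re_neg {z : ℂ} (hz : z.re < 0) : gStar z = -z * (2 * altBeta 1 (-z)) := by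
  rw [← digamma_sub_digamma_eq (by simpa using hz), gStar]
  ring_nf

lemma isModifiedMellinTransform_gStar : IsModifiedMellinTransform orthoKernel gStar := by
  refine ⟨meromorphic_gStar, 0, fun z hz => ?_⟩
  have e : ∀ t : ℝ, orthoKernel t * (t : ℂ) ^ (-z - 1) =
      2 * ((t : ℂ) ^ (-z - 1) * (((1 + t) ^ 1)⁻¹ : ℝ)) := fun t => by
    rw [orthoKernel, div_eq_mul_inv]; push_cast; ring
  simp only [e]
  refine ⟨(integrableOn_unitMellin (continuousOn_inv_one_add_pow 1)
    (by simpa using hz)).const_mul 2, ?_⟩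
  rw [gStar_eq_of_re_neg hz, integral_const_mul]
  rfl

lemma gStar_eq {z : ℂ} (hz : z.re < 2) (h0 : z ≠ 0) (h1 : z ≠ 1) :
    gStar z = 2 * zeroFn (2 - z) / (1 - z) := by
  have hre : 0 < (2 - z).re := by simp; linarith
  have d1 : Complex.digamma (-z / 2 + 1) = Complex.digamma (-z / 2) + (-z / 2)⁻¹ :=
    Complex.digamma_apply_add_one _ fun m h => by
      have h2 : z = ((2 * m : ℕ) : ℂ) := by push_cast; linear_combination -2 * h
      rw [h2, Complex.natCast_re] at hz
      have : m = 0 := by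
        have : 2 * m < 2 := by exact_mod_cast hz
        omega
      exact h0 (by rw [h2, this]; simp)
  have d2 : Complex.digamma ((1 - z) / 2 + 1) = Complex.digamma ((1 - z) / 2) + ((1 - z) / 2)⁻¹ :=
    Complex.digamma_apply_add_one _ fun m h => by
      have h2 : z = ((2 * m + 1 : ℕ) : ℂ) := by push_cast; linear_combination -2 * h
      rw [h2, Complex.natCast_re] at hz
      have : m = 0 := by
        have : 2 * m + 1 < 2 := by exact_mod_cast hz
        omega
      exact h1 (by rw [h2, this]; simp)
  have d3 := digamma_sub_digamma_eq hre
  have e1 : (2 - z + 1) / 2 = (1 - z) / 2 + 1 := by ring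
  have e2 : (2 - z) / 2 = -z / 2 + 1 := by ring
  rw [e1, e2, d1, d2] at d3
  have h1' : 1 - z ≠ 0 := sub_ne_zero.mpr h1.symm
  rw [gStar, zeroFn_eq hre, eq_div_iff h1']
  have d4 : Complex.digamma (-z / 2) - Complex.digamma ((1 - z) / 2) =
      ((1 - z) / 2)⁻¹ - (-z / 2)⁻¹ - 2 * altBeta 1 (2 - z) := by linear_combination -d3
  rw [d4]
  field_simp
  ring

lemma tendsto_gStar_mul {z : ℂ} (hz : z.re < 2) :
    Tendsto (fun x => gStar x * (1 - x)) (𝓝[≠] z) (𝓝 (2 * zeroFn (2 - z))) := by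
  have h1 : ContinuousAt (fun x => 2 * zeroFn (2 - x)) z := by
    have : ContinuousAt zeroFn (2 - z) :=
      (differentiableAt_zeroFn (by simp; linarith)).continuousAt
    exact continuousAt_const.mul (ContinuousAt.comp (f := fun x => 2 - x) this (by fun_prop))
  refine (h1.tendsto.mono_left nhdsWithin_le_nhds).congr' ?_
  have hne : ∀ a : ℂ, ∀ᶠ x in 𝓝[≠] z, x ≠ a := fun a => by
    rcases eq_or_ne a z with rfl | h
    · exact self_mem_nhdsWithin
    · exact nhdsWithin_le_nhds (isOpen_ne.mem_nhds h.symm)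
  filter_upwards [hne 0, hne 1, nhdsWithin_le_nhds
    ((isOpen_lt Complex.continuous_re continuous_const).mem_nhds hz)] with x hx0 hx1 hx2
  have : 1 - x ≠ 0 := sub_ne_zero.mpr hx1.symm
  rw [gStar_eq hx2 hx0 hx1]
  field_simp

/-- The zeros of `g*` in `Re z < 2` are those of `zeroFn (2 - z)`. -/
lemma isMeromorphicZero_gStar_iff {z : ℂ} (hz : z.re < 2) :
    IsMeromorphicZero gStar z ↔ zeroFn (2 - z) = 0 := by
  have ht := tendsto_gStar_mul hz
  have hc : Tendsto (fun x : ℂ => 1 - x) (𝓝[≠] z) (𝓝 (1 - z)) :=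
    (Continuous.tendsto (by fun_prop) z).mono_left nhdsWithin_le_nhds
  rw [IsMeromorphicZero, and_iff_right (meromorphic_gStar z),
    ← tendsto_zero_iff_meromorphicOrderAt_pos (meromorphic_gStar z)]
  constructor
  · intro h
    have := tendsto_nhds_unique ht (h.mul hc)
    simpa using this
  · intro h
    have h1 : 1 - z ≠ 0 := fun h1 => by
      have : z = 1 := by linear_combination -h1
      rw [this] at h
      norm_num [zeroFn_one] at h
    rw [h] at ht
    have h2 := ht.div hc h1
    rw [mul_zero, zero_div] at h2
    refine h2.congr' ?_
    filter_upwards [hc.eventually_ne h1] with x hx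
    exact mul_div_cancel_right₀ _ hx

/-- `g*` has zeros of smallest real part `α`, `α` is close to `1.3465`, and `zeroFn (2 - z) ≠ 0` for
`Re z < α`. -/
lemma exists_isLeast_re_zeros :
    ∃ α : ℝ, IsLeast {x : ℝ | ∃ z : ℂ, IsMeromorphicZero gStar z ∧ z.re = x} α ∧
      |α - 1.3465| < 0.00005 ∧ ∀ s : ℂ, 2 - α < s.re → zeroFn s ≠ 0 := by
  obtain ⟨z₀, h0, hre, hne⟩ := exists_rightmost_zero
  have hre' := abs_le.mp hre
  refine ⟨2 - z₀.re, ⟨⟨2 - z₀, ?_, by simp⟩, ?_⟩, ?_, fun s hs => hne s (by linarith)⟩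
  · rw [isMeromorphicZero_gStar_iff (by simp; linarith [hre'.1]), sub_sub_cancel]
    exact h0
  · rintro x ⟨z, hz, rfl⟩
    by_contra! hlt
    rw [isMeromorphicZero_gStar_iff (by linarith [hre'.1])] at hz
    exact hne (2 - z) (by simp; linarith) hz
  · rw [abs_lt]
    constructor <;> linarith [hre'.1, hre'.2]

/-! ### Shifting vertical lines of integration -/

/-- Vertical line integrals of a holomorphic function that decays like `1 / Im(s)^2` in a closed
strip do not depend on the line. -/
lemma integral_vertical_line_eq {F : ℂ → ℂ} {a b C : ℝ} (hab : a ≤ b)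
    (hd : ∀ s : ℂ, a ≤ s.re → s.re ≤ b → DifferentiableAt ℂ F s)
    (hC : ∀ s : ℂ, a ≤ s.re → s.re ≤ b → ‖F s‖ ≤ C * (1 + s.im ^ 2)⁻¹) :
    ∫ τ : ℝ, F (a + τ * Complex.I) = ∫ τ : ℝ, F (b + τ * Complex.I) := by
  have hint : ∀ x : ℝ, a ≤ x → x ≤ b → Integrable fun τ : ℝ => F (x + τ * Complex.I) := by
    intro x hx hx'
    refine Integrable.mono' (integrable_inv_one_add_sq.const_mul C) ?_ ?_
    · refine Continuous.aestronglyMeasurable (continuous_iff_continuousAt.mpr fun τ => ?_)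
      exact ContinuousAt.comp (f := fun τ : ℝ => (x : ℂ) + τ * Complex.I)
        (hd (x + τ * Complex.I) (by simpa using hx) (by simpa using hx')).continuousAt (by fun_prop)
    · filter_upwards with τ
      simpa using hC (x + τ * Complex.I) (by simpa using hx) (by simpa using hx')
  have hrect : ∀ T : ℝ, (∫ x : ℝ in a..b, F (x + (-T : ℝ) * Complex.I)) -
      (∫ x : ℝ in a..b, F (x + T * Complex.I)) +
      Complex.I * (∫ y : ℝ in (-T)..T, F (b + y * Complex.I)) -
      Complex.I * (∫ y : ℝ in (-T)..T, F (a + y * Complex.I)) = 0 := by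
    intro T
    have := Complex.integral_boundary_rect_eq_zero_of_differentiableOn F ⟨a, -T⟩ ⟨b, T⟩
      (fun s hs => by
        have h1 := hs.1
        rw [mem_preimage, uIcc_of_le hab] at h1
        exact (hd s h1.1 h1.2).differentiableWithinAt)
    simpa using this
  have hhor : ∀ ε : ℝ, ε = 1 ∨ ε = -1 →
      Tendsto (fun T : ℝ => ∫ x : ℝ in a..b, F (x + (ε * T : ℝ) * Complex.I)) atTop (𝓝 0) := by
    intro ε hε
    have hε2 : ε ^ 2 = 1 := by rcases hε with rfl | rfl <;> norm_num
    have hlim : Tendsto (fun T : ℝ => C * (1 + T ^ 2)⁻¹ * |b - a|) atTop (𝓝 0) := by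
      have h1 : Tendsto (fun T : ℝ => (1 + T ^ 2)⁻¹) atTop (𝓝 0) :=
        tendsto_inv_atTop_zero.comp
          (tendsto_atTop_add_const_left _ _ (tendsto_pow_atTop two_ne_zero))
      simpa using (h1.const_mul C).mul_const |b - a|
    refine squeeze_zero_norm (fun T => ?_) hlim
    refine intervalIntegral.norm_integral_le_of_norm_le_const fun x hx => ?_
    rw [uIoc_of_le hab] at hx
    have := hC (x + (ε * T : ℝ) * Complex.I) (by simpa using hx.1.le) (by simpa using hx.2)
    simpa [mul_pow, hε2] using this
  have hver : ∀ x : ℝ, a ≤ x → x ≤ b → Tendsto (fun T : ℝ => ∫ y : ℝ in (-T)..T,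
      F (x + y * Complex.I)) atTop (𝓝 (∫ y : ℝ, F (x + y * Complex.I))) := fun x hx hx' =>
    intervalIntegral_tendsto_integral (hint x hx hx') tendsto_neg_atTop_atBot tendsto_id
  have hlim := (((hhor (-1) (Or.inr rfl)).sub (hhor 1 (Or.inl rfl))).add
    ((hver b hab le_rfl).const_mul Complex.I)).sub ((hver a le_rfl hab).const_mul Complex.I)
  simp only [neg_mul, one_mul, hrect] at hlim
  have h0 := tendsto_nhds_unique hlim tendsto_const_nhds
  have h1 : Complex.I * (∫ y : ℝ, F (b + y * Complex.I)) =
      Complex.I * (∫ y : ℝ, F (a + y * Complex.I)) := by linear_combination h0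
  exact (mul_left_cancel₀ Complex.I_ne_zero h1).symm

/-! ### The symbol of the resolvent -/

/-- The transform `1 / g*(2-s) - 1 + 1/(2s)` of the continuous part of the resolvent kernel: the
term `1/(2s)` removes the leading term of `1 - 1/g*` at infinity. -/
noncomputable def resolventSymbol (s : ℂ) : ℂ := (s - 1) / (2 * zeroFn s) - 1 + 1 / (2 * s)

lemma ne_zero_of_re_pos {s : ℂ} (hs : 0 < s.re) : s ≠ 0 := by
  rintro rfl; simp at hs

lemma differentiableAt_resolventSymbol {s : ℂ} (hs : 0 < s.re) (h : zeroFn s ≠ 0) :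
    DifferentiableAt ℂ resolventSymbol s := by
  unfold resolventSymbol
  have h1 := differentiableAt_zeroFn hs
  have h2 := ne_zero_of_re_pos hs
  refine ((DifferentiableAt.div (by fun_prop) (by fun_prop) (by simpa using h)).sub
    (by fun_prop)).add (DifferentiableAt.div (by fun_prop) (by fun_prop) (by simpa using h2))

/-- `zeroFn` grows linearly: by compactness for bounded `s`, and by its definition for large `s`. -/
lemma exists_norm_zeroFn_ge {σ : ℝ} (hσ : 0 < σ) (hne : ∀ s : ℂ, σ ≤ s.re → zeroFn s ≠ 0) :
    ∃ δ : ℝ, 0 < δ ∧ ∀ s : ℂ, σ ≤ s.re → δ * ‖s‖ ≤ ‖zeroFn s‖ := by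
  set R : ℝ := 1 + 8 / σ with hR
  set K : Set ℂ := Metric.closedBall 0 R ∩ {s | σ ≤ s.re} with hK
  have hKc : IsCompact K := (isCompact_closedBall 0 R).inter_right
    (isClosed_le continuous_const Complex.continuous_re)
  have hcont : ContinuousOn (fun s => ‖zeroFn s‖) K := fun s hs =>
    (differentiableAt_zeroFn (hσ.trans_le hs.2)).continuousAt.norm.continuousWithinAt
  obtain ⟨m, hm, hmK⟩ := hKc.exists_forall_le' hcont
    fun s hs => norm_pos_iff.mpr (hne s hs.2)
  have hRpos : 0 < R := by positivity
  refine ⟨min (m / R) (1 / 4), lt_min (by positivity) (by norm_num), fun s hs => ?_⟩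
  rcases le_or_gt ‖s‖ R with h | h
  · calc min (m / R) (1 / 4) * ‖s‖ ≤ m / R * R := by
          gcongr
          exact min_le_left _ _
      _ = m := by field_simp
      _ ≤ _ := hmK s ⟨by simpa using h, hs⟩
  · have hJ : ‖altBeta 3 s‖ ≤ 1 / σ := (norm_altBeta_le 3 (hσ.trans_le hs)).trans (by gcongr)
    have h1 : s / 2 = zeroFn s + 1 / 4 - 2 * altBeta 3 s := by rw [zeroFn]; ring
    have h2 : ‖s‖ / 2 ≤ ‖zeroFn s‖ + 1 / 4 + 2 * (1 / σ) := by
      have := congrArg norm h1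
      rw [norm_div, Complex.norm_ofNat] at this
      rw [this]
      refine (norm_sub_le _ _).trans (add_le_add ((norm_add_le _ _).trans ?_) ?_)
      · norm_num
      · rw [norm_mul, Complex.norm_ofNat]; gcongr
    have h3 : min (m / R) (1 / 4) * ‖s‖ ≤ 1 / 4 * ‖s‖ := by gcongr; exact min_le_right _ _
    have h4 : 8 / σ = 8 * (1 / σ) := by ring
    rw [hR, h4] at h
    linarith

/-- The numerator of `resolventSymbol` over the denominator `2 s zeroFn s` is bounded, after an
integration by parts in `s * altBeta 3 s`. -/
lemma exists_norm_resolventSymbol_le {σ : ℝ} (hσ : 0 < σ)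
    (hne : ∀ s : ℂ, σ ≤ s.re → zeroFn s ≠ 0) :
    ∃ C : ℝ, 0 ≤ C ∧ ∀ s : ℂ, σ ≤ s.re → ‖resolventSymbol s‖ ≤ C * (1 + s.im ^ 2)⁻¹ := by
  obtain ⟨δ, hδ, hG⟩ := exists_norm_zeroFn_ge hσ hne
  set N : ℝ := 1 / 4 + 2 * (1 / σ) + 4 * (1 / 8 + 3 * (1 / σ)) with hN
  have hm : 0 < min 1 (σ ^ 2) := lt_min one_pos (by positivity)
  refine ⟨N / (2 * δ) / min 1 (σ ^ 2), by positivity, fun s hs => ?_⟩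
  have hpos : 0 < s.re := hσ.trans_le hs
  have hs0 := ne_zero_of_re_pos hpos
  have hz := hne s hs
  have e : resolventSymbol s =
      (-(1 / 4) + 2 * altBeta 3 s - 4 * (s * altBeta 3 s)) / (2 * (s * zeroFn s)) := by
    rw [resolventSymbol]
    field_simp
    rw [zeroFn]
    ring
  have hnum : ‖-(1 / 4) + 2 * altBeta 3 s - 4 * (s * altBeta 3 s)‖ ≤ N := by
    have h3 : ‖altBeta 3 s‖ ≤ 1 / σ := (norm_altBeta_le 3 hpos).trans (by gcongr)
    have h4 : ‖altBeta 4 (s + 1)‖ ≤ 1 / σ := by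
      refine (norm_altBeta_le 4 (by simp; linarith)).trans ?_
      gcongr
      simp; linarith
    rw [mul_altBeta 3 hpos]
    refine (norm_sub_le _ _).trans (add_le_add ((norm_add_le _ _).trans (add_le_add ?_ ?_)) ?_)
    · norm_num
    · rw [norm_mul, Complex.norm_ofNat]; gcongr
    · rw [norm_mul, Complex.norm_ofNat]
      gcongr
      refine (norm_add_le _ _).trans (add_le_add (by norm_num) ?_)
      rw [norm_mul]
      norm_num
      simpa using h4
  have hden : 2 * δ * ‖s‖ ^ 2 ≤ ‖2 * (s * zeroFn s)‖ := by
    rw [norm_mul, norm_mul, Complex.norm_ofNat]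
    nlinarith [mul_le_mul_of_nonneg_left (hG s hs) (norm_nonneg s)]
  have hs2 : min 1 (σ ^ 2) * (1 + s.im ^ 2) ≤ ‖s‖ ^ 2 := by
    rw [← Complex.normSq_eq_norm_sq, Complex.normSq_apply]
    nlinarith [min_le_left 1 (σ ^ 2), min_le_right 1 (σ ^ 2), sq_nonneg s.im,
      mul_le_mul_of_nonneg_right (min_le_left 1 (σ ^ 2)) (sq_nonneg s.im)]
  have hn : 0 < ‖s‖ := norm_pos_iff.mpr hs0
  rw [e, norm_div]
  calc _ ≤ N / (2 * δ * ‖s‖ ^ 2) := by gcongr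
    _ ≤ N / (2 * δ * (min 1 (σ ^ 2) * (1 + s.im ^ 2))) := by gcongr
    _ = _ := by field_simp

open FourierTransform in
/-- The kernel with transform `resolventSymbol`, on the line `Re s = 3`; moving the line to the left
as far as `zeroFn` has no zeros gives the decay at `+∞`, moving it to the right shows that the
kernel vanishes on the negative half-line. -/
lemma exists_continuous_kernel {σ : ℝ} (hσ : 0 < σ) (hσ3 : σ < 3)
    (hne : ∀ s : ℂ, σ ≤ s.re → zeroFn s ≠ 0) :
    ∃ (ρ : ℝ → ℂ) (C : ℝ), Continuous ρ ∧ Integrable ρ ∧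
      (∀ v, ‖ρ v‖ ≤ C * Real.exp ((σ - 3) * v)) ∧ (∀ v < 0, ρ v = 0) ∧
      ∀ ξ : ℝ, 𝓕 ρ ξ = resolventSymbol (3 + 2 * Real.pi * ξ * Complex.I) := by
  obtain ⟨C, hC0, hC⟩ := exists_norm_resolventSymbol_le hσ hne
  have hdiff : ∀ s : ℂ, σ ≤ s.re → DifferentiableAt ℂ resolventSymbol s := fun s hs =>
    differentiableAt_resolventSymbol (hσ.trans_le hs) (hne s hs)
  set f : ℝ → ℂ := fun ξ => resolventSymbol (3 + 2 * Real.pi * ξ * Complex.I) with hf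
  have hre : ∀ ξ : ℝ, (3 + 2 * Real.pi * ξ * Complex.I : ℂ).re = 3 := fun ξ => by simp
  have him : ∀ ξ : ℝ, (3 + 2 * Real.pi * ξ * Complex.I : ℂ).im = 2 * Real.pi * ξ := fun ξ => by
    simp
  have hfc : Continuous f := continuous_iff_continuousAt.mpr fun ξ =>
    ContinuousAt.comp (f := fun ξ : ℝ => (3 + 2 * Real.pi * ξ * Complex.I : ℂ))
      (hdiff _ (by rw [hre]; exact hσ3.le)).continuousAt (by fun_prop)
  have hpi : (2 * Real.pi) ≠ 0 := by positivity
  have hfi : Integrable f := by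
    refine Integrable.mono' ((integrable_inv_one_add_sq.comp_mul_left' hpi).const_mul C)
      hfc.aestronglyMeasurable ?_
    filter_upwards with ξ
    have := hC _ ((hσ3.le).trans_eq (hre ξ).symm)
    rwa [him] at this
  have hshift : ∀ v b : ℝ, σ ≤ b →
      ‖𝓕⁻ f v‖ ≤ C / 2 * Real.exp ((b - 3) * v) := by
    intro v b hb
    set F : ℂ → ℂ := fun s => resolventSymbol s * Complex.exp (s * v) with hF
    have hFd : ∀ s : ℂ, σ ≤ s.re → DifferentiableAt ℂ F s := fun s hs => by
      have := hdiff s hs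
      simp only [hF]
      fun_prop
    have hFn : ∀ s : ℂ, σ ≤ s.re → ‖F s‖ ≤ C * Real.exp (s.re * v) * (1 + s.im ^ 2)⁻¹ := by
      intro s hs
      simp only [hF]
      rw [norm_mul, Complex.norm_exp]
      have : (s * v).re = s.re * v := by simp
      rw [this]
      calc _ ≤ C * (1 + s.im ^ 2)⁻¹ * Real.exp (s.re * v) := by gcongr; exact hC s hs
        _ = _ := by ring
    have hstrip : ∀ a b : ℝ, σ ≤ a → a ≤ b →
        ∫ τ : ℝ, F (a + τ * Complex.I) = ∫ τ : ℝ, F (b + τ * Complex.I) := by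
      intro a b ha hab
      refine integral_vertical_line_eq (C := C * Real.exp (|b| * |v| + |a| * |v|)) hab
        (fun s hs _ => hFd s (ha.trans hs)) fun s hs hs' => (hFn s (ha.trans hs)).trans ?_
      gcongr
      have h1 : |s.re| ≤ |b| + |a| := by
        rw [abs_le]
        constructor
        · linarith [neg_abs_le a, abs_nonneg b]
        · linarith [le_abs_self b, abs_nonneg a]
      calc s.re * v ≤ |s.re| * |v| := by rw [← abs_mul]; exact le_abs_self _
        _ ≤ (|b| + |a|) * |v| := by gcongr
        _ = _ := by ring
    have heq : ∫ τ : ℝ, F ((3 : ℝ) + τ * Complex.I) = ∫ τ : ℝ, F (b + τ * Complex.I) := by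
      rcases le_total b 3 with h | h
      · exact (hstrip b 3 hb h).symm
      · exact hstrip 3 b hσ3.le h
    have hinv : (Real.exp (3 * v) : ℂ) * 𝓕⁻ f v =
        (2 * (Real.pi : ℂ))⁻¹ * ∫ τ : ℝ, F ((3 : ℝ) + τ * Complex.I) := by
      have h1 := Measure.integral_comp_mul_left (fun τ : ℝ => F ((3 : ℝ) + τ * Complex.I))
        (2 * Real.pi)
      rw [abs_of_pos (by positivity), Complex.real_smul] at h1
      push_cast at h1
      rw [Complex.ofReal_ofNat, ← h1, Real.fourierInv_eq', ← integral_const_mul]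
      congr 1 with ξ
      simp only [hF, hf, smul_eq_mul]
      rw [mul_left_comm, mul_comm (resolventSymbol _), ← mul_assoc, Complex.ofReal_exp,
        ← Complex.exp_add]
      congr 2
      · simp
        ring
    have hnb : ‖∫ τ : ℝ, F (b + τ * Complex.I)‖ ≤ C * Real.exp (b * v) * Real.pi := by
      rw [← integral_univ_inv_one_add_sq, ← integral_const_mul]
      refine norm_integral_le_of_norm_le (integrable_inv_one_add_sq.const_mul _) ?_
      filter_upwards with τ
      simpa using hFn (b + τ * Complex.I) (by simpa using hb)
    have hn := congrArg norm hinv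
    rw [heq, norm_mul, norm_mul, Complex.norm_real, Real.norm_eq_abs,
      abs_of_pos (Real.exp_pos _)] at hn
    have e1 : ‖((2 * Real.pi : ℂ))⁻¹‖ = (2 * Real.pi)⁻¹ := by
      rw [norm_inv, norm_mul, Complex.norm_ofNat, Complex.norm_real, Real.norm_eq_abs,
        abs_of_pos Real.pi_pos]
    rw [e1] at hn
    have e2 : Real.exp ((b - 3) * v) = Real.exp (b * v) / Real.exp (3 * v) := by
      rw [← Real.exp_sub]; ring_nf
    rw [e2, ← mul_div_assoc, le_div_iff₀ (Real.exp_pos _), mul_comm, hn]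
    calc _ ≤ (2 * Real.pi)⁻¹ * (C * Real.exp (b * v) * Real.pi) := by gcongr
      _ = _ := by have := Real.pi_pos.ne'; field_simp
  have hcont : Continuous (𝓕⁻ f) := by
    have h1 : Continuous (𝓕 f) := VectorFourier.fourierIntegral_continuous
      Real.continuous_fourierChar (by exact continuous_inner) hfi
    have h2 : 𝓕⁻ f = fun v => 𝓕 f (-v) := funext fun v => Real.fourierInv_eq_fourier_neg f v
    rw [h2]
    exact h1.comp continuous_neg
  have hneg : ∀ v < 0, 𝓕⁻ f v = 0 := by
    intro v hv
    have hlim : Tendsto (fun b : ℝ => C / 2 * Real.exp ((b - 3) * v)) atTop (𝓝 0) := by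
      have h1 : Tendsto (fun b : ℝ => (b - 3) * v) atTop atBot :=
        (tendsto_atTop_add_const_right _ (-3) tendsto_id).atTop_mul_const_of_neg hv
      simpa using (Real.tendsto_exp_atBot.comp h1).const_mul (C / 2)
    refine norm_le_zero_iff.mp (ge_of_tendsto hlim ?_)
    filter_upwards [eventually_ge_atTop σ] with b hb using hshift v b hb
  have hint : Integrable (𝓕⁻ f) := by
    have h1 : IntegrableOn (fun v : ℝ => C / 2 * Real.exp ((σ - 3) * v)) (Ioi 0) :=
      (integrableOn_exp_mul_Ioi (by linarith) 0).const_mul _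
    have h2 : IntegrableOn (𝓕⁻ f) (Ioi 0) := Integrable.mono' h1 hcont.aestronglyMeasurable
      (Eventually.of_forall fun v => hshift v σ le_rfl)
    have h3 : IntegrableOn (𝓕⁻ f) (Iic 0) := by
      rw [integrableOn_Iic_iff_integrableOn_Iio]
      exact integrableOn_zero.congr_fun (fun v hv => (hneg v hv).symm) measurableSet_Iio
    rw [← integrableOn_univ, ← Iic_union_Ioi (a := (0 : ℝ))]
    exact h3.union h2
  have hint' : Integrable (𝓕 f) := by
    have h2 : 𝓕 f = fun v => 𝓕⁻ f (-v) := funext fun v => by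
      rw [Real.fourierInv_eq_fourier_neg, neg_neg]
    rw [h2]
    exact hint.comp_neg
  refine ⟨𝓕⁻ f, C / 2, hcont, hint, fun v => hshift v σ le_rfl, hneg, fun ξ => ?_⟩
  rw [hfc.fourier_fourierInv_eq hfi hint']

/-! ### The resolvent of the convolution equation -/

/-- The function `f` on `(0, 1]` in the logarithmic variable `t = e^(-u)`, with the weight
`e^(-σ u)`; it vanishes for `u < 0`. -/
noncomputable def logWeight (f : ℝ → ℝ) (σ u : ℝ) : ℂ :=
  Real.exp (-σ * u) • (Ioc (0 : ℝ) 1).indicator (fun t => (f t : ℂ)) (Real.exp (-u))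

lemma logWeight_of_nonneg (f : ℝ → ℝ) (σ : ℝ) {u : ℝ} (hu : 0 ≤ u) :
    logWeight f σ u = ((Real.exp (-σ * u) * f (Real.exp (-u)) : ℝ) : ℂ) := by
  have : Real.exp (-u) ∈ Ioc (0 : ℝ) 1 := ⟨Real.exp_pos _, Real.exp_le_one_iff.mpr (by linarith)⟩
  rw [logWeight, indicator_of_mem this, Complex.real_smul]
  push_cast; rfl

lemma logWeight_of_neg (f : ℝ → ℝ) (σ : ℝ) {u : ℝ} (hu : u < 0) : logWeight f σ u = 0 := by
  have : Real.exp (-u) ∉ Ioc (0 : ℝ) 1 := fun h => by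
    have := Real.exp_le_one_iff.mp h.2
    linarith
  rw [logWeight, indicator_of_notMem this, smul_zero]

lemma logWeight_eq_indicator (f : ℝ → ℝ) (σ : ℝ) :
    logWeight f σ = (Ici (0 : ℝ)).indicator
      fun u => ((Real.exp (-σ * u) * f (Real.exp (-u)) : ℝ) : ℂ) := by
  ext u
  rcases lt_or_ge u 0 with h | h
  · rw [logWeight_of_neg f σ h, indicator_of_notMem (by simpa using h)]
  · rw [logWeight_of_nonneg f σ h, indicator_of_mem (by simpa using h)]

lemma continuousOn_logWeight_aux {f : ℝ → ℝ} (hf : ContinuousOn f (Icc 0 1)) (σ : ℝ) :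
    ContinuousOn (fun u => ((Real.exp (-σ * u) * f (Real.exp (-u)) : ℝ) : ℂ)) (Ici 0) := by
  refine Complex.continuous_ofReal.comp_continuousOn (ContinuousOn.mul (by fun_prop) ?_)
  refine hf.comp (by fun_prop) fun u hu => ⟨(Real.exp_pos _).le, Real.exp_le_one_iff.mpr ?_⟩
  have : (0 : ℝ) ≤ u := hu
  linarith

lemma norm_logWeight_le {f : ℝ → ℝ} {C : ℝ} (hC : ∀ t ∈ Icc (0 : ℝ) 1, ‖f t‖ ≤ C) (σ : ℝ) {u : ℝ}
    (hu : 0 ≤ u) : ‖logWeight f σ u‖ ≤ C * Real.exp (-σ * u) := by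
  rw [logWeight_of_nonneg f σ hu, Complex.norm_real, norm_mul, Real.norm_eq_abs,
    abs_of_pos (Real.exp_pos _), mul_comm]
  gcongr
  exact hC _ ⟨(Real.exp_pos _).le, Real.exp_le_one_iff.mpr (by linarith)⟩

lemma integrable_logWeight {f : ℝ → ℝ} (hf : ContinuousOn f (Icc 0 1)) {σ : ℝ} (hσ : 0 < σ) :
    Integrable (logWeight f σ) := by
  obtain ⟨C, hC⟩ := isCompact_Icc.exists_bound_of_continuousOn hf
  have h1 : IntegrableOn (fun u : ℝ => C * Real.exp (-σ * u)) (Ici 0) := by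
    rw [integrableOn_Ici_iff_integrableOn_Ioi]
    exact (integrableOn_exp_mul_Ioi (by linarith) 0).const_mul _
  rw [logWeight_eq_indicator, integrable_indicator_iff measurableSet_Ici]
  refine Integrable.mono' h1
    ((continuousOn_logWeight_aux hf σ).aestronglyMeasurable measurableSet_Ici) ?_
  filter_upwards [ae_restrict_mem measurableSet_Ici] with u hu
  rw [← logWeight_of_nonneg f σ hu]
  exact norm_logWeight_le hC σ hu

lemma exists_norm_logWeight_le {f : ℝ → ℝ} (hf : ContinuousOn f (Icc 0 1)) {σ : ℝ} (hσ : 0 ≤ σ) :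
    ∃ C : ℝ, ∀ u, ‖logWeight f σ u‖ ≤ C := by
  obtain ⟨C, hC⟩ := isCompact_Icc.exists_bound_of_continuousOn hf
  have hC0 : 0 ≤ C := (norm_nonneg _).trans (hC 0 (by simp))
  refine ⟨C, fun u => ?_⟩
  rcases lt_or_ge u 0 with h | h
  · rw [logWeight_of_neg f σ h, norm_zero]; exact hC0
  · refine (norm_logWeight_le hC σ h).trans (mul_le_of_le_one_right hC0 ?_)
    rw [Real.exp_le_one_iff]
    nlinarith

lemma continuousAt_logWeight {f : ℝ → ℝ} (hf : ContinuousOn f (Icc 0 1)) (σ : ℝ) {u : ℝ}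
    (hu : u ≠ 0) : ContinuousAt (logWeight f σ) u := by
  rcases hu.lt_or_gt with h | h
  · refine continuousAt_const.congr (f := fun _ => (0 : ℂ)) ?_
    filter_upwards [gt_mem_nhds h] with v hv
    exact (logWeight_of_neg f σ hv).symm
  · refine ((continuousOn_logWeight_aux hf σ).continuousAt (Ici_mem_nhds h)).congr ?_
    filter_upwards [lt_mem_nhds h] with v hv
    exact (logWeight_of_nonneg f σ hv.le).symm

open FourierTransform in
lemma fourier_logWeight (f : ℝ → ℝ) (σ ξ : ℝ) :
    𝓕 (logWeight f σ) ξ = unitMellin f (σ + 2 * Real.pi * ξ * Complex.I) := by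
  rw [unitMellin_eq_mellin, mellin_eq_fourier]
  have h1 : ((σ : ℂ) + 2 * Real.pi * ξ * Complex.I).re = σ := by simp
  have h2 : ((σ : ℂ) + 2 * Real.pi * ξ * Complex.I).im / (2 * Real.pi) = ξ := by
    simp
  rw [h1, h2]
  rfl

open Convolution ContinuousLinearMap in
/-- The convolution of an integrable function with a bounded function that is continuous except at
one point is continuous. -/
lemma continuous_convolution_of_continuousAt_ne {f g : ℝ → ℂ} (hf : Integrable f)
    (hgm : AEStronglyMeasurable g) {C : ℝ} (hC : ∀ u, ‖g u‖ ≤ C)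
    (hg : ∀ u ≠ 0, ContinuousAt g u) : Continuous (f ⋆[mul ℂ ℂ] g) := by
  refine continuous_iff_continuousAt.mpr fun x₀ => ?_
  have hb : ∀ᶠ x in 𝓝 x₀, ∀ᵐ t : ℝ, ‖mul ℂ ℂ (f t) (g (x - t))‖ ≤ ‖f t‖ * C := by
    filter_upwards with x
    filter_upwards with t
    rw [mul_apply', norm_mul]
    gcongr
    exact hC _
  refine continuousAt_of_dominated ?_ hb (hf.norm.mul_const C) ?_
  · exact Eventually.of_forall fun x =>
      hf.aestronglyMeasurable.convolution_integrand_snd' (mul ℂ ℂ) (hgm.mono_ac (by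
        exact (quasiMeasurePreserving_sub_left_of_right_invariant volume x).absolutelyContinuous))
  · have : ∀ᵐ t : ℝ, t ≠ x₀ := by simp [ae_iff]
    filter_upwards [this] with t ht
    simp only [mul_apply']
    refine continuousAt_const.mul ?_
    exact ContinuousAt.comp (f := fun x => x - t) (hg _ (sub_ne_zero.mpr ht.symm)) (by fun_prop)

open FourierTransform in
lemma fourier_add_apply {f g : ℝ → ℂ} (hf : Integrable f) (hg : Integrable g) (ξ : ℝ) :
    𝓕 (fun u => f u + g u) ξ = 𝓕 f ξ + 𝓕 g ξ := by
  have := VectorFourier.fourierIntegral_add (μ := volume) (L := innerₗ ℝ)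
    Real.continuous_fourierChar (by exact continuous_inner) hf hg
  exact congrFun this ξ

open FourierTransform in
lemma fourier_const_mul_apply (c : ℂ) (f : ℝ → ℂ) (ξ : ℝ) :
    𝓕 (fun u => c * f u) ξ = c * 𝓕 f ξ := by
  rw [Real.fourier_eq', Real.fourier_eq', ← integral_const_mul]
  congr 1 with u
  simp only [smul_eq_mul]
  ring

open FourierTransform in
lemma eq_zero_of_fourier_eq_zero {d : ℝ → ℂ} (hd : Integrable d) (h : ∀ ξ, 𝓕 d ξ = 0) {v : ℝ}
    (hv : ContinuousAt d v) : d v = 0 := by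
  have h1 : 𝓕 d = 0 := funext h
  rw [← hd.fourierInv_fourier_eq (by rw [h1]; exact integrable_zero _ _ _) hv, h1,
    Real.fourierInv_eq']
  simp

/-- The kernel `1/(1+t)`, whose Mellin transform is `altBeta 1`, in the logarithmic variable. -/
noncomputable def logKernel : ℝ → ℂ := logWeight (fun t => ((1 + t) ^ 1)⁻¹) 1

lemma logKernel_of_nonneg {u : ℝ} (hu : 0 ≤ u) :
    logKernel u = ((1 / (1 + Real.exp u) : ℝ) : ℂ) := by
  rw [logKernel, logWeight_of_nonneg _ _ hu]
  congr 1
  rw [pow_one, neg_mul, one_mul, Real.exp_neg]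
  field_simp
  ring

lemma logKernel_of_neg {u : ℝ} (hu : u < 0) : logKernel u = 0 := logWeight_of_neg _ _ hu

open Convolution ContinuousLinearMap FourierTransform in
/-- Inversion of the convolution equation with kernel `2/(1+e^u)`: the resolvent kernel `r` lives on
the positive half-line and decays there as fast as the zeros of `g*` allow. It is the kernel with
transform `resolventSymbol`, minus `e^(-3v) / 2`. -/
lemma exists_resolvent {σ : ℝ} (hσ : 0 < σ) (hσ3 : σ < 3)
    (hne : ∀ s : ℂ, σ ≤ s.re → zeroFn s ≠ 0) :
    ∃ (r : ℝ → ℂ) (C : ℝ), Integrable r ∧ (∀ v < 0, r v = 0) ∧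
      (∀ v, 0 ≤ v → ‖r v‖ ≤ C * Real.exp ((σ - 3) * v)) ∧
      ∀ v, 0 ≤ v →
        ((Real.exp (-v) : ℝ) : ℂ) = 2 * logKernel v + ∫ t, r t * (2 * logKernel (v - t)) := by
  obtain ⟨ρ, C, hρc, hρi, hρC, hρ0, hρF⟩ := exists_continuous_kernel hσ hσ3 hne
  have hone : ContinuousOn (fun _ : ℝ => (1 : ℝ)) (Icc 0 1) := continuousOn_const
  have hk := continuousOn_inv_one_add_pow 1
  set H : ℝ → ℂ := logWeight (fun _ => 1) 3 with hH
  set ua : ℝ → ℂ := logWeight (fun _ => 1) 1 with hua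
  have hHi : Integrable H := integrable_logWeight hone (by norm_num)
  have huai : Integrable ua := integrable_logWeight hone (by norm_num)
  have hki : Integrable logKernel := integrable_logWeight hk (by norm_num)
  set uh : ℝ → ℂ := fun u => 2 * logKernel u with huh
  have huhi : Integrable uh := hki.const_mul 2
  set r : ℝ → ℂ := fun u => ρ u + (-(1 / 2)) * H u with hr
  have hri : Integrable r := hρi.add (hHi.const_mul _)
  have hua_nonneg : ∀ u, 0 ≤ u → ua u = ((Real.exp (-u) : ℝ) : ℂ) := fun u hu => by
    rw [hua, logWeight_of_nonneg _ _ hu]; simp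
  have hH_nonneg : ∀ u, 0 ≤ u → H u = ((Real.exp (-3 * u) : ℝ) : ℂ) := fun u hu => by
    rw [hH, logWeight_of_nonneg _ _ hu]; simp
  obtain ⟨B, hB⟩ := exists_norm_logWeight_le hk (σ := 1) (by norm_num)
  have huhB : ∀ u, ‖uh u‖ ≤ 2 * B := fun u => by
    rw [huh, norm_mul, Complex.norm_ofNat]
    exact mul_le_mul_of_nonneg_left (hB u) (by norm_num)
  have huhc : ∀ u ≠ 0, ContinuousAt uh u := fun u hu =>
    continuousAt_const.mul (continuousAt_logWeight hk 1 hu)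
  have hconv : Continuous (r ⋆[mul ℂ ℂ] uh) :=
    continuous_convolution_of_continuousAt_ne hri huhi.aestronglyMeasurable huhB huhc
  have hconvi : Integrable (r ⋆[mul ℂ ℂ] uh) := hri.integrable_convolution _ huhi
  set d : ℝ → ℂ := fun u => (uh u + (-1) * ua u) + (r ⋆[mul ℂ ℂ] uh) u with hd
  have hd1 : Integrable fun u => uh u + (-1) * ua u := huhi.add (huai.const_mul _)
  have hdi : Integrable d := hd1.add hconvi
  -- On the Fourier side the equation is the relation between `zeroFn s` and `altBeta 1 (s - 2)`.
  have hdF : ∀ ξ, 𝓕 d ξ = 0 := by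
    intro ξ
    have huF : 𝓕 uh ξ = 2 * unitMellin (fun t => ((1 + t) ^ 1)⁻¹)
        ((1 : ℝ) + 2 * Real.pi * ξ * Complex.I) := by
      rw [huh, fourier_const_mul_apply, logKernel, fourier_logWeight]
    have haF : 𝓕 (fun u => (-1) * ua u) ξ =
        (-1) * unitMellin (fun _ => 1) ((1 : ℝ) + 2 * Real.pi * ξ * Complex.I) := by
      rw [fourier_const_mul_apply, hua, fourier_logWeight]
    have hHF : 𝓕 (fun u => (-(1 / 2)) * H u) ξ =
        (-(1 / 2)) * unitMellin (fun _ => 1) ((3 : ℝ) + 2 * Real.pi * ξ * Complex.I) := by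
      rw [fourier_const_mul_apply, hH, fourier_logWeight]
    rw [hd, fourier_add_apply hd1 hconvi, fourier_add_apply huhi (huai.const_mul _), haF,
      Real.fourier_mul_convolution_eq hri huhi, huF, hr, fourier_add_apply hρi (hHi.const_mul _),
      hHF, hρF]
    set s : ℂ := 3 + 2 * Real.pi * ξ * Complex.I with hs
    have hsre : s.re = 3 := by simp [hs]
    have e3 : ((3 : ℝ) : ℂ) + 2 * Real.pi * ξ * Complex.I = s := by rw [hs]; norm_num
    have e1 : ((1 : ℝ) : ℂ) + 2 * Real.pi * ξ * Complex.I = s - 2 := by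
      rw [hs]; push_cast; ring
    rw [e3, e1]
    have hre2 : 0 < (s - 2).re := by simp [hsre]; norm_num
    have hre1 : 0 < (s - 1).re := by simp [hsre]
    have hre0 : 0 < s.re := by rw [hsre]; norm_num
    rw [unitMellin_one hre2, unitMellin_one hre0]
    change 2 * altBeta 1 (s - 2) + -1 * (1 / (s - 2)) +
      (resolventSymbol s + -(1 / 2) * (1 / s)) * (2 * altBeta 1 (s - 2)) = 0
    have r2 := altBeta_one_add hre2
    have r1 := altBeta_one_add hre1
    rw [show s - 2 + 1 = s - 1 by ring] at r2
    rw [sub_add_cancel] at r1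
    have n2 := ne_zero_of_re_pos hre2
    have n1 := ne_zero_of_re_pos hre1
    have n0 := ne_zero_of_re_pos hre0
    have hz : zeroFn s ≠ 0 := hne s (by rw [hsre]; exact hσ3.le)
    have hzs : zeroFn s = (s - 1) * (s - 2) * altBeta 1 (s - 2) := by
      rw [zeroFn_eq hre0]
      have : altBeta 1 (s - 2) = 1 / (s - 2) - 1 / (s - 1) + altBeta 1 s := by
        linear_combination r2 - r1
      rw [this]
      field_simp
      ring
    have hb : altBeta 1 (s - 2) ≠ 0 := fun h => hz (by rw [hzs, h, mul_zero])
    rw [resolventSymbol, hzs]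
    field_simp
    ring
  have hconv_def : ∀ v, (r ⋆[mul ℂ ℂ] uh) v = ∫ t, r t * (2 * logKernel (v - t)) := fun v => rfl
  have hr0 : ∀ v < 0, r v = 0 := fun v hv => by
    rw [hr]
    simp only [hρ0 v hv, hH, logWeight_of_neg _ _ hv, mul_zero, add_zero]
  refine ⟨r, C + 1 / 2, hri, hr0, fun v hv => ?_, fun v hv => ?_⟩
  · rw [hr]
    refine (norm_add_le _ _).trans ?_
    rw [add_mul]
    refine add_le_add (hρC v) ?_
    rw [norm_mul, norm_neg, hH_nonneg v hv, Complex.norm_real,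
      Real.norm_eq_abs, abs_of_pos (Real.exp_pos _)]
    norm_num
    nlinarith
  · rcases hv.eq_or_lt with rfl | hv'
    · -- At `v = 0` the two factors of the integrand have essentially disjoint supports.
      have h1 : ∫ t, r t * (2 * logKernel (0 - t)) = 0 := by
        refine integral_eq_zero_of_ae ?_
        have : ∀ᵐ t : ℝ, t ≠ 0 := by simp [ae_iff]
        filter_upwards [this] with t ht
        rcases ht.lt_or_gt with h | h
        · simp [hr0 t h]
        · simp [logKernel_of_neg (show -t < 0 by linarith)]
      rw [h1, logKernel_of_nonneg le_rfl]
      norm_num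
    · have hdc : ContinuousAt d v :=
        ((huhc v hv'.ne').add (continuousAt_const.mul (continuousAt_logWeight hone 1 hv'.ne'))).add
          hconv.continuousAt
      have h := eq_zero_of_fourier_eq_zero hdi hdF hdc
      simp only [hd, hconv_def, hua_nonneg v hv] at h
      simp only [huh] at h
      linear_combination -h

/-! ### The recurrence as a convolution equation, and decay of the partial sums -/

/-- The nodes `k + 1/2`, for which the recurrence has the symmetric denominators
`N + k + 1 = node N + node k`. -/
noncomputable def node (k : ℕ) : ℝ := k + 1 / 2

lemma node_pos (k : ℕ) : 0 < node k := by unfold node; positivity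

lemma node_succ (k : ℕ) : node (k + 1) = node k + 1 := by unfold node; push_cast; ring

lemma node_mono {j k : ℕ} (h : j ≤ k) : node j ≤ node k := by
  unfold node
  have : (j : ℝ) ≤ k := by exact_mod_cast h
  linarith

/-- The partial sums `c 0 + ... + c n`. -/
noncomputable def partialSum (c : ℕ → ℝ) (n : ℕ) : ℝ := ∑ k ∈ Finset.range (n + 1), c k

/-- Abel summation. -/
lemma sum_mul_eq_partialSum (c w : ℕ → ℝ) (n : ℕ) :
    ∑ k ∈ Finset.range (n + 1), c k * w k =
      partialSum c n * w n + ∑ k ∈ Finset.range n, partialSum c k * (w k - w (k + 1)) := by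
  induction n with
  | zero => simp [partialSum]
  | succ n ih =>
    rw [Finset.sum_range_succ, ih, Finset.sum_range_succ _ n]
    have : partialSum c (n + 1) = partialSum c n + c (n + 1) := Finset.sum_range_succ _ _
    rw [this]; ring

/-- Up to sign, the recurrence expresses a partial sum as a combination of the earlier ones with
positive coefficients of total weight `N / (N + 1)`. -/
lemma abs_partialSum_le_one {c : ℕ → ℝ} (hc0 : c 0 = 1)
    (hc : ∀ N : ℕ, 1 ≤ N → ∑ k ∈ Finset.range (N + 1), c k / (node N + node k) = 0) (N : ℕ) :
    |partialSum c N| ≤ 1 := by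
  induction N using Nat.strong_induction_on with
  | _ N ih =>
    rcases Nat.eq_zero_or_pos N with rfl | hN
    · simp [partialSum, hc0]
    set w : ℕ → ℝ := fun k => 1 / (node N + node k) with hw
    have hanti : ∀ k, 0 ≤ w k - w (k + 1) := fun k => by
      have := node_pos N
      have := node_pos k
      rw [sub_nonneg, hw]
      simp only [node_succ]
      gcongr
      linarith
    have h := hc N hN
    simp only [div_eq_mul_one_div (c _)] at h
    have h' := sum_mul_eq_partialSum c w N
    rw [h] at h'
    have hwN : 0 < w N := by have := node_pos N; simp only [hw]; positivity
    have hw0 : w 0 ≤ 2 * w N := by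
      have := node_pos N
      have := node_pos 0
      simp only [hw]
      rw [show 2 * (1 / (node N + node N)) = 1 / node N by field_simp; ring]
      gcongr
      linarith
    have hs : |∑ k ∈ Finset.range N, partialSum c k * (w k - w (k + 1))| ≤ w 0 - w N := by
      rw [← Finset.sum_range_sub' w N]
      refine (Finset.abs_sum_le_sum_abs _ _).trans (Finset.sum_le_sum fun k hk => ?_)
      rw [abs_mul, abs_of_nonneg (hanti k)]
      exact mul_le_of_le_one_left (hanti k) (ih k (Finset.mem_range.mp hk))
    have h2 : |partialSum c N| * w N ≤ 1 * w N := by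
      rw [← abs_of_pos hwN, ← abs_mul, abs_of_pos hwN,
        show partialSum c N * w N =
          -∑ k ∈ Finset.range N, partialSum c k * (w k - w (k + 1)) by linarith, abs_neg]
      linarith
    exact le_of_mul_le_mul_right h2 hwN

lemma rpow_node_le_sub {a : ℝ} (ha0 : 0 ≤ a) (ha1 : a < 1) (k : ℕ) :
    node k ^ (-a) ≤ 3 ^ a / (1 - a) * (node (k + 1) ^ (1 - a) - node k ^ (1 - a)) := by
  have hk := node_pos k
  have hk1 := node_pos (k + 1)
  have hp : 0 < 1 - a := by linarith
  have e := node_succ k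
  have hm : node (k + 1) ≤ 3 * node k := by
    have := node_mono (Nat.zero_le k)
    have h0 : node 0 = 1 / 2 := by simp [node]
    linarith
  -- Bernoulli's inequality for the concave power `1 - a`
  have hB := rpow_one_add_le_one_add_mul_self (s := -1 / node (k + 1)) (p := 1 - a)
    (by rw [le_div_iff₀ hk1]; linarith) hp.le (by linarith)
  have e1 : 1 + -1 / node (k + 1) = node k / node (k + 1) := by field_simp; linarith
  rw [e1, Real.div_rpow hk.le hk1.le, div_le_iff₀ (Real.rpow_pos_of_pos hk1 _)] at hB
  have e2 : node (k + 1) ^ (1 - a) = node (k + 1) * node (k + 1) ^ (-a) := by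
    rw [sub_eq_add_neg, Real.rpow_add hk1, Real.rpow_one]
  have h1 : (1 - a) * node (k + 1) ^ (-a) ≤ node (k + 1) ^ (1 - a) - node k ^ (1 - a) := by
    have : (1 + (1 - a) * (-1 / node (k + 1))) * node (k + 1) ^ (1 - a) =
        node (k + 1) ^ (1 - a) - (1 - a) * node (k + 1) ^ (-a) := by
      rw [e2]; field_simp; ring
    linarith
  have h2 : node k ^ (-a) ≤ 3 ^ a * node (k + 1) ^ (-a) := by
    have : (3 * node k) ^ (-a) ≤ node (k + 1) ^ (-a) :=
      Real.rpow_le_rpow_of_nonpos hk1 hm (by linarith)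
    rw [Real.mul_rpow (by norm_num) hk.le, Real.rpow_neg (by norm_num)] at this
    rwa [← inv_mul_le_iff₀ (by positivity)]
  calc node k ^ (-a) ≤ 3 ^ a * node (k + 1) ^ (-a) := h2
    _ = 3 ^ a / (1 - a) * ((1 - a) * node (k + 1) ^ (-a)) := by field_simp
    _ ≤ _ := by gcongr

lemma sum_rpow_node_le {a : ℝ} (ha0 : 0 ≤ a) (ha1 : a < 1) (n : ℕ) :
    ∑ k ∈ Finset.range n, node k ^ (-a) ≤ 3 ^ a / (1 - a) * node n ^ (1 - a) := by
  have hp : 0 < 1 - a := by linarith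
  calc ∑ k ∈ Finset.range n, node k ^ (-a)
      ≤ ∑ k ∈ Finset.range n,
          3 ^ a / (1 - a) * (node (k + 1) ^ (1 - a) - node k ^ (1 - a)) :=
        Finset.sum_le_sum fun k _ => rpow_node_le_sub ha0 ha1 k
    _ = 3 ^ a / (1 - a) * (node n ^ (1 - a) - node 0 ^ (1 - a)) := by
        rw [← Finset.mul_sum, Finset.sum_range_sub fun k => node k ^ (1 - a)]
    _ ≤ _ := by
        gcongr
        have := Real.rpow_nonneg (node_pos 0).le (1 - a)
        linarith

/-- Between two nodes the sum `∑ c k / (x + node k)`, which vanishes at the left one, is smaller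
than the partial sums by two powers of `x`. -/
lemma exists_abs_sum_div_le {c : ℕ → ℝ}
    (hc : ∀ N : ℕ, 1 ≤ N → ∑ k ∈ Finset.range (N + 1), c k / (node N + node k) = 0)
    {a B : ℝ} (ha0 : 0 ≤ a) (ha1 : a < 1) (hB : ∀ k, |partialSum c k| ≤ B * node k ^ (-a)) :
    ∃ C : ℝ, 0 ≤ C ∧ ∀ (n : ℕ) (x : ℝ), node n ≤ x → x ≤ node (n + 1) →
      |∑ k ∈ Finset.range (n + 1), c k / (x + node k)| ≤ C * x ^ (-(a + 2)) := by
  have hB0 : 0 ≤ B := by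
    have h := (abs_nonneg _).trans (hB 0)
    exact nonneg_of_mul_nonneg_left h (Real.rpow_pos_of_pos (node_pos 0) _)
  set D : ℝ := 3 ^ a / (1 - a) with hD
  have hD0 : 0 ≤ D := div_nonneg (by positivity) (by linarith)
  have h0 : node 0 = 1 / 2 := by simp [node]
  -- passing from the node to `x` costs at most this factor
  have hx3 : ∀ (n : ℕ) (x : ℝ), node n ≤ x → x ≤ node (n + 1) →
      node n ^ (-(a + 2)) ≤ 3 ^ (a + 2) * x ^ (-(a + 2)) := fun n x h1 h2 => by
    have hm := node_pos n
    have hx : 0 < x := hm.trans_le h1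
    have hx3 : x ≤ 3 * node n := by
      have := node_mono (Nat.zero_le n)
      rw [node_succ] at h2
      linarith
    have := Real.rpow_le_rpow_of_nonpos hx hx3 (z := -(a + 2)) (by linarith)
    rw [Real.mul_rpow (by norm_num) hm.le, Real.rpow_neg (by norm_num)] at this
    rwa [← inv_mul_le_iff₀ (by positivity)]
  refine ⟨(|c 0| + B * (1 + 2 * D)) * 3 ^ (a + 2), by positivity, fun n x h1 h2 => ?_⟩
  have hm := node_pos n
  have hx : 0 < x := hm.trans_le h1
  suffices h : |∑ k ∈ Finset.range (n + 1), c k / (x + node k)| ≤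
      (|c 0| + B * (1 + 2 * D)) * node n ^ (-(a + 2)) by
    refine h.trans ?_
    rw [mul_assoc]
    exact mul_le_mul_of_nonneg_left (hx3 n x h1 h2) (by positivity)
  rcases Nat.eq_zero_or_pos n with rfl | hn
  · simp only [zero_add, Finset.range_one, Finset.sum_singleton]
    rw [abs_div, abs_of_pos (by linarith : 0 < x + node 0)]
    have e1 : |c 0| / (x + node 0) ≤ |c 0| := by
      refine div_le_self (abs_nonneg _) ?_
      rw [h0] at h1 ⊢
      linarith
    have e2 : 1 ≤ node 0 ^ (-(a + 2)) :=
      Real.one_le_rpow_of_pos_of_le_one_of_nonpos (node_pos 0) (by rw [h0]; norm_num) (by linarith)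
    calc |c 0| / (x + node 0) ≤ |c 0| := e1
      _ ≤ (|c 0| + B * (1 + 2 * D)) * 1 := by
          have : 0 ≤ B * (1 + 2 * D) := by positivity
          linarith
      _ ≤ _ := by gcongr
  set m := node n with hmdef
  -- the weights that remain after subtraction of the recurrence at `n`
  set w : ℕ → ℝ := fun k => (x - m) / ((x + node k) * (m + node k)) with hw
  have hxm0 : 0 ≤ x - m := by linarith
  have hxm1 : x - m ≤ 1 := by rw [node_succ] at h2; linarith
  have hsum : ∑ k ∈ Finset.range (n + 1), c k / (x + node k) =
      -∑ k ∈ Finset.range (n + 1), c k * w k := by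
    rw [← sub_zero (∑ k ∈ Finset.range (n + 1), c k / (x + node k)), ← hc n hn,
      ← Finset.sum_sub_distrib, ← Finset.sum_neg_distrib]
    refine Finset.sum_congr rfl fun k _ => ?_
    have := node_pos k
    change c k / (x + node k) - c k / (m + node k) =
      -(c k * ((x - m) / ((x + node k) * (m + node k))))
    field_simp
    ring
  have hwn : |w n| ≤ 1 / m ^ 2 := by
    simp only [hw]
    rw [abs_of_nonneg (by positivity)]
    gcongr
    nlinarith
  have hdiff : ∀ k, |w k - w (k + 1)| ≤ 2 / m ^ 3 := fun k => by
    have hk := node_pos k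
    set y := node k
    have e : w k - w (k + 1) = (x - m) * (1 / ((m + y) * (x + y + 1) * (m + y + 1)) +
        1 / ((x + y) * (m + y) * (x + y + 1))) := by
      simp only [hw, node_succ]
      change (x - m) / ((x + y) * (m + y)) - (x - m) / ((x + (y + 1)) * (m + (y + 1))) = _
      field_simp
      ring
    have e1 : 1 / ((m + y) * (x + y + 1) * (m + y + 1)) ≤ 1 / m ^ 3 := by
      rw [show m ^ 3 = m * m * m by ring]
      gcongr <;> linarith
    have e2 : 1 / ((x + y) * (m + y) * (x + y + 1)) ≤ 1 / m ^ 3 := by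
      rw [show m ^ 3 = m * m * m by ring]
      gcongr <;> linarith
    rw [e, abs_of_nonneg (by positivity)]
    calc _ ≤ 1 * (1 / m ^ 3 + 1 / m ^ 3) := by gcongr
      _ = 2 / m ^ 3 := by ring
  rw [hsum, abs_neg, sum_mul_eq_partialSum]
  have p2 : m ^ (-a) * (1 / m ^ 2) = m ^ (-(a + 2)) := by
    rw [neg_add, Real.rpow_add hm, Real.rpow_neg hm.le 2, one_div, Real.rpow_two]
  have p3 : m ^ (1 - a) * (1 / m ^ 3) = m ^ (-(a + 2)) := by
    rw [show -(a + 2) = (1 - a) + -(3 : ℕ) by push_cast; ring, Real.rpow_add hm,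
      Real.rpow_neg hm.le, Real.rpow_natCast, one_div]
  calc _ ≤ |partialSum c n * w n| +
        |∑ k ∈ Finset.range n, partialSum c k * (w k - w (k + 1))| := abs_add_le _ _
    _ ≤ B * m ^ (-a) * (1 / m ^ 2) +
        ∑ k ∈ Finset.range n, B * node k ^ (-a) * (2 / m ^ 3) := by
        refine add_le_add ?_ ((Finset.abs_sum_le_sum_abs _ _).trans
          (Finset.sum_le_sum fun k _ => ?_))
        · rw [abs_mul]
          have := hB n
          gcongr
        · rw [abs_mul]
          have := hB k
          have := hdiff k
          have := Real.rpow_nonneg (node_pos k).le (-a)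
          gcongr
    _ = B * m ^ (-(a + 2)) +
        B * (2 * (1 / m ^ 3)) * ∑ k ∈ Finset.range n, node k ^ (-a) := by
        rw [mul_assoc, p2, Finset.mul_sum]
        congr 1
        refine Finset.sum_congr rfl fun k _ => ?_
        ring
    _ ≤ B * m ^ (-(a + 2)) + B * (2 * (1 / m ^ 3)) * (D * m ^ (1 - a)) := by
        have := sum_rpow_node_le ha0 ha1 n
        gcongr
    _ = B * (1 + 2 * D) * m ^ (-(a + 2)) := by linear_combination (2 * B * D) * p3
    _ ≤ _ := by
        have := Real.rpow_nonneg hm.le (-(a + 2))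
        gcongr
        have := abs_nonneg (c 0)
        linarith

/-- The forcing term of the convolution equation. It is the sum `∑ 2 c k / (e^y + node k)` over the
`k ≤ N` with `node k ≤ e^y`. -/
noncomputable def forcing (c : ℕ → ℝ) (N : ℕ) (y : ℝ) : ℂ :=
  ∑ k ∈ Finset.range (N + 1),
    ((c k / node k : ℝ) : ℂ) * (2 * logKernel (y - Real.log (node k)))

lemma forcing_of_lt (c : ℕ → ℝ) (N : ℕ) {y : ℝ} (hy : y < Real.log (node 0)) :
    forcing c N y = 0 := by
  refine Finset.sum_eq_zero fun k _ => ?_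
  have := Real.log_le_log (node_pos 0) (node_mono (Nat.zero_le k))
  rw [logKernel_of_neg (by linarith), mul_zero, mul_zero]

lemma forcing_term_eq (c : ℕ → ℝ) (k : ℕ) {y : ℝ} (hy : node k ≤ Real.exp y) :
    ((c k / node k : ℝ) : ℂ) * (2 * logKernel (y - Real.log (node k))) =
      ((2 * (c k / (Real.exp y + node k)) : ℝ) : ℂ) := by
  have hk := node_pos k
  have h := (Real.log_le_iff_le_exp hk).mpr hy
  rw [logKernel_of_nonneg (by linarith), Real.exp_sub, Real.exp_log hk]
  norm_cast
  have := Real.exp_pos y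
  field_simp
  ring

lemma forcing_eq (c : ℕ → ℝ) {N n : ℕ} (hn : n ≤ N) {y : ℝ} (h1 : node n ≤ Real.exp y)
    (h2 : Real.exp y < node (n + 1)) :
    forcing c N y =
      ((2 * ∑ k ∈ Finset.range (n + 1), c k / (Real.exp y + node k) : ℝ) : ℂ) := by
  have hsub : Finset.range (n + 1) ⊆ Finset.range (N + 1) :=
    Finset.range_subset_range.mpr (by omega)
  rw [forcing, ← Finset.sum_subset hsub fun k _ hk => ?_, Finset.mul_sum, Complex.ofReal_sum]
  · refine Finset.sum_congr rfl fun k hk => forcing_term_eq c k ?_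
    exact (node_mono (by have := Finset.mem_range.mp hk; omega)).trans h1
  · have hk' : n + 1 ≤ k := by simpa using hk
    have h3 : y < Real.log (node k) := by
      rw [Real.lt_log_iff_exp_lt (node_pos k)]
      exact h2.trans_le (node_mono hk')
    rw [logKernel_of_neg (by linarith), mul_zero, mul_zero]

lemma exists_norm_forcing_le {c : ℕ → ℝ}
    (hc : ∀ N : ℕ, 1 ≤ N → ∑ k ∈ Finset.range (N + 1), c k / (node N + node k) = 0)
    {a B : ℝ} (ha0 : 0 ≤ a) (ha1 : a < 1) (hB : ∀ k, |partialSum c k| ≤ B * node k ^ (-a)) :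
    ∃ C : ℝ, 0 ≤ C ∧ ∀ (N : ℕ) (y : ℝ), Real.log (node 0) ≤ y → y ≤ Real.log (node N) →
      ‖forcing c N y‖ ≤ C * Real.exp (-(a + 2) * y) := by
  obtain ⟨C, hC0, hC⟩ := exists_abs_sum_div_le hc ha0 ha1 hB
  refine ⟨2 * C, by positivity, fun N y h0 hN => ?_⟩
  rw [Real.log_le_iff_le_exp (node_pos 0)] at h0
  rw [Real.le_log_iff_exp_le (node_pos N)] at hN
  have e0 : node 0 = 1 / 2 := by simp [node]
  rw [e0] at h0
  set n := ⌊Real.exp y - 1 / 2⌋₊ with hn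
  have h1 : node n ≤ Real.exp y := by
    have := Nat.floor_le (sub_nonneg.mpr h0)
    unfold node; linarith
  have h2 : Real.exp y < node (n + 1) := by
    have := Nat.lt_floor_add_one (Real.exp y - 1 / 2)
    rw [node_succ]; unfold node; linarith
  have hnN : n ≤ N := by
    have : (n : ℝ) ≤ N := by
      have := h1.trans hN
      unfold node at this; linarith
    exact_mod_cast this
  rw [forcing_eq c hnN h1 h2, Complex.norm_real, Real.norm_eq_abs, abs_mul, abs_two, mul_assoc]
  gcongr
  refine (hC n _ h1 h2.le).trans (le_of_eq ?_)
  rw [Real.rpow_def_of_pos (Real.exp_pos y), Real.log_exp, mul_comm y]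

/-- The partial sums solve the convolution equation with the forcing term and the resolvent. -/
lemma partialSum_eq_integral {c : ℕ → ℝ}
    (hc : ∀ N : ℕ, 1 ≤ N → ∑ k ∈ Finset.range (N + 1), c k / (node N + node k) = 0)
    {r : ℝ → ℂ} (hr : Integrable r)
    (hrk : ∀ v, 0 ≤ v →
      ((Real.exp (-v) : ℝ) : ℂ) = 2 * logKernel v + ∫ t, r t * (2 * logKernel (v - t)))
    {N : ℕ} (hN : 1 ≤ N) :
    ((partialSum c N / node N : ℝ) : ℂ) =
      ∫ t, r t * forcing c N (Real.log (node N) - t) := by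
  have hk := continuousOn_inv_one_add_pow 1
  have hki : Integrable logKernel := integrable_logWeight hk (by norm_num)
  obtain ⟨B, hB⟩ := exists_norm_logWeight_le hk (σ := 1) (by norm_num)
  have hint : ∀ v, Integrable fun t => r t * (2 * logKernel (v - t)) := fun v => by
    refine hr.mul_bdd (c := 2 * B) ((hki.const_mul 2).comp_sub_left v).aestronglyMeasurable ?_
    filter_upwards with t
    rw [norm_mul, Complex.norm_ofNat]
    exact mul_le_mul_of_nonneg_left (hB _) (by norm_num)
  have hterm : ∀ k ∈ Finset.range (N + 1), ((c k / node N : ℝ) : ℂ) =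
      ((2 * (c k / (node N + node k)) : ℝ) : ℂ) +
        ∫ t, r t * (((c k / node k : ℝ) : ℂ) *
          (2 * logKernel (Real.log (node N) - t - Real.log (node k)))) := fun k hk' => by
    have hkN : node k ≤ node N := node_mono (by have := Finset.mem_range.mp hk'; omega)
    have hkp := node_pos k
    have hNp := node_pos N
    have h := hrk (Real.log (node N) - Real.log (node k))
      (sub_nonneg.mpr (Real.log_le_log hkp hkN))
    have h3 := forcing_term_eq c k (y := Real.log (node N)) (by rwa [Real.exp_log hNp])
    rw [Real.exp_log hNp] at h3
    have h4 : ∫ t, r t * (((c k / node k : ℝ) : ℂ) *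
          (2 * logKernel (Real.log (node N) - t - Real.log (node k)))) =
        ((c k / node k : ℝ) : ℂ) *
          ∫ t, r t * (2 * logKernel (Real.log (node N) - Real.log (node k) - t)) := by
      rw [← integral_const_mul]
      congr 1 with t
      rw [sub_right_comm]
      ring
    rw [← h3, h4, ← mul_add, ← h, neg_sub, Real.exp_sub, Real.exp_log hNp, Real.exp_log hkp]
    norm_cast
    field_simp
  have hsum := Finset.sum_congr rfl hterm
  rw [Finset.sum_add_distrib, ← Complex.ofReal_sum, ← Complex.ofReal_sum, ← Finset.mul_sum,
    hc N hN, ← Finset.sum_div, mul_zero, Complex.ofReal_zero, zero_add,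
    ← integral_finsetSum] at hsum
  · rw [partialSum, hsum]
    congr 1 with t
    rw [forcing, Finset.mul_sum]
  · intro k _
    have := (hint (Real.log (node N) - Real.log (node k))).const_mul ((c k / node k : ℝ) : ℂ)
    refine this.congr (Eventually.of_forall fun t => ?_)
    simp only
    rw [sub_right_comm]
    ring

/-- One step of the bootstrap: decay of the partial sums of order `a < 1` improves to any order
`b < a + 1` that stays to the left of the zeros of `g*`. -/
lemma exists_abs_partialSum_le_of_decay {c : ℕ → ℝ} (hc0 : c 0 = 1)
    (hc : ∀ N : ℕ, 1 ≤ N → ∑ k ∈ Finset.range (N + 1), c k / (node N + node k) = 0)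
    {a B b : ℝ} (ha0 : 0 ≤ a) (ha1 : a < 1) (hB : ∀ k, |partialSum c k| ≤ B * node k ^ (-a))
    (hb0 : 0 ≤ b) (hba : b < a + 1) (hne : ∀ s : ℂ, 2 - b ≤ s.re → zeroFn s ≠ 0) :
    ∃ K : ℝ, ∀ k, |partialSum c k| ≤ K * node k ^ (-b) := by
  obtain ⟨r, C, hri, hr0, hrC, hrk⟩ := exists_resolvent (by linarith) (by linarith) hne
  obtain ⟨F, hF0, hF⟩ := exists_norm_forcing_le hc ha0 ha1 hB
  have hC0 : 0 ≤ C := by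
    have := (norm_nonneg _).trans (hrC 0 le_rfl)
    simpa using this
  set δ := a + 1 - b with hδ
  have hδ0 : 0 < δ := by linarith
  set ℓ₀ := Real.log (node 0) with hℓ₀
  set K := C * F * (Real.exp (-δ * ℓ₀) / δ) with hK
  refine ⟨max K 1, fun N => ?_⟩
  rcases Nat.eq_zero_or_pos N with rfl | hN
  · have h1 : 1 ≤ node 0 ^ (-b) :=
      Real.one_le_rpow_of_pos_of_le_one_of_nonpos (node_pos 0) (by simp [node]; norm_num)
        (by linarith)
    have h2 : |partialSum c 0| = 1 := by simp [partialSum, hc0]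
    calc |partialSum c 0| = 1 * 1 := by rw [h2, one_mul]
      _ ≤ _ := mul_le_mul (le_max_right _ _) h1 zero_le_one (by positivity)
  set ℓ := Real.log (node N) with hℓ
  have hNp := node_pos N
  have hbound : ∀ᵐ t : ℝ, ‖r t * forcing c N (ℓ - t)‖ ≤
      (Iic (ℓ - ℓ₀)).indicator
        (fun t => C * F * Real.exp (-(a + 2) * ℓ) * Real.exp (δ * t)) t := by
    filter_upwards with t
    rcases lt_or_ge (ℓ - ℓ₀) t with h | h
    · rw [indicator_of_notMem (by simpa using h), forcing_of_lt c N (by linarith), mul_zero,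
        norm_zero]
    rw [indicator_of_mem (by simpa using h), norm_mul]
    rcases lt_or_ge t 0 with ht | ht
    · rw [hr0 t ht, norm_zero, zero_mul]
      positivity
    calc ‖r t‖ * ‖forcing c N (ℓ - t)‖
        ≤ (C * Real.exp ((2 - b - 3) * t)) * (F * Real.exp (-(a + 2) * (ℓ - t))) :=
          mul_le_mul (hrC t ht) (hF N _ (by linarith) (by linarith)) (norm_nonneg _)
            (by positivity)
      _ = C * F * (Real.exp ((2 - b - 3) * t) * Real.exp (-(a + 2) * (ℓ - t))) := by ring
      _ = C * F * (Real.exp (-(a + 2) * ℓ) * Real.exp (δ * t)) := by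
          rw [← Real.exp_add, ← Real.exp_add, hδ]
          ring_nf
      _ = _ := by ring
  have hgi : Integrable ((Iic (ℓ - ℓ₀)).indicator
      (fun t => C * F * Real.exp (-(a + 2) * ℓ) * Real.exp (δ * t))) := by
    rw [integrable_indicator_iff measurableSet_Iic]
    exact (integrableOn_exp_mul_Iic hδ0 _).const_mul _
  have h := norm_integral_le_of_norm_le hgi hbound
  rw [← partialSum_eq_integral hc hri hrk hN, integral_indicator measurableSet_Iic,
    integral_const_mul, integral_exp_mul_Iic hδ0, Complex.norm_real, norm_div,
    Real.norm_eq_abs, Real.norm_eq_abs, abs_of_pos hNp, div_le_iff₀ hNp] at h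
  refine h.trans ?_
  have e1 : C * F * Real.exp (-(a + 2) * ℓ) * (Real.exp (δ * (ℓ - ℓ₀)) / δ) * node N =
      K * node N ^ (-b) := by
    have e2 : node N = Real.exp ℓ := (Real.exp_log hNp).symm
    have e3 : node N ^ (-b) = Real.exp (-(a + 2) * ℓ) * Real.exp (δ * ℓ) * node N := by
      rw [Real.rpow_def_of_pos hNp, e2, ← Real.exp_add, ← Real.exp_add, Real.log_exp, hδ]
      ring_nf
    rw [e3, hK, show δ * (ℓ - ℓ₀) = δ * ℓ + -δ * ℓ₀ by ring, Real.exp_add]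
    ring
  rw [e1]
  have := Real.rpow_nonneg hNp.le (-b)
  gcongr
  exact le_max_left _ _

/-- Two bootstrap steps lead from boundedness to the decay given by the first zeros of `g*`. -/
lemma exists_abs_partialSum_le {c : ℕ → ℝ} (hc0 : c 0 = 1)
    (hc : ∀ N : ℕ, 1 ≤ N → ∑ k ∈ Finset.range (N + 1), c k / (node N + node k) = 0)
    {α b : ℝ} (hα : 1 < α) (hα' : α < 1.9) (hne : ∀ s : ℂ, 2 - α < s.re → zeroFn s ≠ 0)
    (hb : b < α) : ∃ K : ℝ, ∀ k, |partialSum c k| ≤ K * node k ^ (-max b 0) := by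
  have h0 : ∀ k, |partialSum c k| ≤ 1 * node k ^ (-(0 : ℝ)) := fun k => by
    simpa using abs_partialSum_le_one hc0 hc k
  obtain ⟨B, hB⟩ := exists_abs_partialSum_le_of_decay hc0 hc le_rfl zero_lt_one h0
    (b := 0.9) (by norm_num) (by norm_num) fun s hs => hne s (by linarith)
  have hb1 : max b 0 < α := max_lt hb (by linarith)
  exact exists_abs_partialSum_le_of_decay hc0 hc (by norm_num) (by norm_num) hB
    (le_max_right b 0) (by linarith) fun s hs => hne s (by linarith)

theorem theorem1p1 (c : ℕ → ℝ) (hc0 : c 0 = 1)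
    (hc : ∀ N : ℕ, 1 ≤ N →
      ∑ k ∈ Finset.range (N + 1), c k / ((N : ℝ) + (k : ℝ) + 1) = 0) :
    IsModifiedMellinTransform orthoKernel gStar ∧
      ∃ α₁ : ℝ,
        IsLeast {x : ℝ | ∃ z : ℂ, IsMeromorphicZero gStar z ∧ z.re = x} α₁ ∧
        |α₁ - 1.3465| < 0.00005 ∧
        ∀ ε : ℝ, 0 < ε → ∃ K : ℝ, ∀ N : ℕ, 1 ≤ N →
          |∑ k ∈ Finset.range (N + 1), c k| ≤ K * (N : ℝ) ^ (-α₁ + ε) := by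
  obtain ⟨α, hleast, hα, hne⟩ := exists_isLeast_re_zeros
  refine ⟨isModifiedMellinTransform_gStar, α, hleast, hα, fun ε hε => ?_⟩
  have hα' := abs_lt.mp hα
  have hc' : ∀ N : ℕ, 1 ≤ N →
      ∑ k ∈ Finset.range (N + 1), c k / (node N + node k) = 0 := fun N hN => by
    rw [← hc N hN]
    refine Finset.sum_congr rfl fun k _ => ?_
    rw [node, node]
    congr 1
    ring
  obtain ⟨K, hK⟩ := exists_abs_partialSum_le hc0 hc' (b := α - ε) (by linarith) (by linarith) hne
    (by linarith)
  refine ⟨K, fun N hN => (hK N).trans ?_⟩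
  have hK0 : 0 ≤ K :=
    nonneg_of_mul_nonneg_left ((abs_nonneg _).trans (hK 0)) (Real.rpow_pos_of_pos (node_pos 0) _)
  have hN1 : (1 : ℝ) ≤ N := by exact_mod_cast hN
  refine mul_le_mul_of_nonneg_left ?_ hK0
  calc node N ^ (-max (α - ε) 0) ≤ (N : ℝ) ^ (-max (α - ε) 0) := by
        refine Real.rpow_le_rpow_of_nonpos (by linarith) ?_ (neg_nonpos.mpr (le_max_right _ _))
        unfold node; linarith
    _ ≤ (N : ℝ) ^ (-α + ε) := by
        refine Real.rpow_le_rpow_of_exponent_le hN1 ?_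
        have := le_max_left (α - ε) 0
        linarith
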